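/- Let $d\ge 1$, let $N_1,\dots,N_d$ be independent standard Gaussian random variables, and let $\lambda_i,\beta_i>0$ $(i\le d)$. For $u>0$ let $\gamma_u>0$ with $\lim_{u\to\infty}\gamma_u=\gamma\in(0,\infty)$, and let $A_u$ be a lower triangular non-singular $d\times d$ matrix such that $\Sigma_u=A_uA_u^\top=(\sigma_{ij}(u))$ is a correlation matrix. Put $Y(u)=A_uN$, $X_i(u)=\lambda_i e^{\beta_i\gamma_uY_i(u)}$, $S(u)=\sum_{i=1}^dX_i(u)$, $M(u)=\max_{i\le d}X_i(u)$ and $\alpha(u)=\mathbb P(S(u)>u)$. For each $j$ let $$Z_j(u)=\mathbb P\bigl(S(u)>u,\;X_j(u)=M(u)\,\big|\,N_k,\ k\neq j\bigr),$$ where, for this $j$, $Y(u)$ is built with any matrix $A_u^{(j)}$ in place of $A_u$ such that $A_u^{(j)}(A_u^{(j)})^\top=\Sigma_u$ and $Y_j(u)=N_j$. Let $\mathcal I=\mathcal I_u$ be a random index, independent of $N$, with $\mathbb P(\mathcal I=i)=\mathbb P(X_i(u)>u)/\sum_{k=1}^d\mathbb P(X_k(u)>u)$. The stratified modified Asmussen–Kroese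 estimator is $$Z_{MAK}(u)=\Bigl(\sum_{i=1}^d\mathbb P(X_i(u)>u)\Bigr)\sum_{i=1}^d\mathbb I_{\{\mathcal I=i\}}\frac{Z_i(u)}{\mathbb P(X_i(u)>u)}.$$ Set $e(x)=x/\log x$, $J=\{j:\beta_j=\max_{i\le d}\beta_i\}$ and $$e_i^*(u)=\beta_i\gamma_u\,u\;e\!\left(\left(\tfrac u{\lambda_i}\right)^{1/(\beta_i\gamma_u)}\right)\left(\tfrac u{\lambda_i}\right)^{-1/(\beta_i\gamma_u)}.$$ **Theorem.** Suppose that for all $c>0$ and $\epsilon>0$ there exists $u_0>0$ such that for all $u>u_0$ and all $i\neq j$ in $J$ $$\sigma_{ij}(u)+c\sqrt{\frac{1-\sigma_{ij}(u)^2}{\log u}}\;\le\;\frac{\beta_j}{\beta_i}\,\frac{\log(\epsilon\, e_i^*(u))}{\log u}.$$ Then $Z_{MAK}(u)$ is an estimator of $\alpha(u)$ with asymptotically vanishing relative error: for every $u>0$ it is square integrable with $\mathbb E[Z_{MAK}(u)]=\alpha(u)$, and $$\lim_{u\to\infty}\mathbb E\left[\left(\frac{Z_{MAK}(u)}{\alpha(u)}\right)^2\right]=1.$$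 -/

import Mathlib

open MeasureTheory ProbabilityTheory Filter Topology

noncomputable section

namespace LogGaussian

variable {d : ℕ} {Ω : Type*} [MeasurableSpace Ω]

/-- The matrix `Σ = A Aᵀ` of correlations `σ i j`. -/
def corr (A : Matrix (Fin d) (Fin d) ℝ) : Matrix (Fin d) (Fin d) ℝ := A * A.transpose

/-- The Gaussian vector `Y = A N`. -/
def gaussVec (A : Matrix (Fin d) (Fin d) ℝ) (N : Fin d → Ω → ℝ) (i : Fin d) (ω : Ω) : ℝ :=
  (A.mulVec (fun k => N k ω)) i

/-- The log-Gaussian risk `X i = lam i * exp (bet i * g * Y i)`, where `Y = A N`. -/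
def risk (lam bet : Fin d → ℝ) (g : ℝ) (A : Matrix (Fin d) (Fin d) ℝ) (N : Fin d → Ω → ℝ)
    (i : Fin d) (ω : Ω) : ℝ :=
  lam i * Real.exp (bet i * g * gaussVec A N i ω)

/-- The aggregated risk `S = ∑ i, X i`. -/
def aggRisk (lam bet : Fin d → ℝ) (g : ℝ) (A : Matrix (Fin d) (Fin d) ℝ) (N : Fin d → Ω → ℝ)
    (ω : Ω) : ℝ :=
  ∑ i, risk lam bet g A N i ω

/-- The largest risk `M = max_i X i`. -/
def maxRisk (lam bet : Fin d → ℝ) (g : ℝ) (A : Matrix (Fin d) (Fin d) ℝ) (N : Fin d → Ω → ℝ)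
    (ω : Ω) : ℝ :=
  ⨆ i, risk lam bet g A N i ω

/-- The probability `α(u) = P(S > u)`. -/
def tailProb (μ : Measure Ω) (lam bet : Fin d → ℝ) (g : ℝ) (A : Matrix (Fin d) (Fin d) ℝ)
    (N : Fin d → Ω → ℝ) (u : ℝ) : ℝ :=
  μ.real {ω | u < aggRisk lam bet g A N ω}

/-- The marginal tail `P(X i > u)`. -/
def margTail (μ : Measure Ω) (lam bet : Fin d → ℝ) (g : ℝ) (A : Matrix (Fin d) (Fin d) ℝ)
    (N : Fin d → Ω → ℝ) (u : ℝ) (i : Fin d) : ℝ :=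
  μ.real {ω | u < risk lam bet g A N i ω}

/-- The σ-algebra generated by `N_{-j}`, that is by all `N k` with `k ≠ j`. -/
abbrev sigmaExcept (N : Fin d → Ω → ℝ) (j : Fin d) : MeasurableSpace Ω :=
  MeasurableSpace.comap (fun (ω : Ω) (k : {k : Fin d // k ≠ j}) => N k ω) inferInstance

/-- `B` is a square root of the correlation matrix `Sig` for which `(B N) j = N j`. -/
def IsFactorAt (Sig : Matrix (Fin d) (Fin d) ℝ) (j : Fin d) (B : Matrix (Fin d) (Fin d) ℝ) :
    Prop :=
  B * B.transpose = Sig ∧ ∀ k, B j k = if k = j then 1 else 0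

/-- The conditional max-sum estimator `Z j = P(S > u, X j = M | N_{-j})`, the risks being built
from the factor `B`. -/
def condEst (μ : Measure Ω) (lam bet : Fin d → ℝ) (g : ℝ) (B : Matrix (Fin d) (Fin d) ℝ)
    (N : Fin d → Ω → ℝ) (u : ℝ) (j : Fin d) : Ω → ℝ :=
  μ⟦{ω | u < aggRisk lam bet g B N ω ∧ risk lam bet g B N j ω = maxRisk lam bet g B N ω}
    | sigmaExcept N j⟧

/-- The stratified modified Asmussen–Kroese estimator
`(∑ i, P(X i > u)) * ∑ i, 1{I = i} * Z i / P(X i > u)`; the estimator `Z i` uses the factor `B i`. -/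
def mak (μ : Measure Ω) (lam bet : Fin d → ℝ) (g : ℝ) (A : Matrix (Fin d) (Fin d) ℝ)
    (B : Fin d → Matrix (Fin d) (Fin d) ℝ) (N : Fin d → Ω → ℝ) (I : Ω → Fin d) (u : ℝ)
    (ω : Ω) : ℝ :=
  (∑ i, margTail μ lam bet g A N u i) *
    ∑ i, (if I ω = i then 1 else 0) *
      (condEst μ lam bet g (B i) N u i ω / margTail μ lam bet g A N u i)

/-- `Z` is a square-integrable unbiased estimator of `α` with asymptotically vanishing relative
error. -/
def VanishingRelativeError (μ : Measure Ω) (Z : ℝ → Ω → ℝ) (α : ℝ → ℝ) : Prop :=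
  (∀ u, 0 < u → MemLp (Z u) 2 μ ∧ ∫ ω, Z u ω ∂μ = α u) ∧
    Tendsto (fun u => ∫ ω, (Z u ω / α u) ^ 2 ∂μ) atTop (𝓝 1)

/-- The scaling function `e(x) = x / log x` of the standard log-normal distribution. -/
def scaleFun (x : ℝ) : ℝ := x / Real.log x

/-- `e*(u) = b g u e(v) v⁻¹` with `v = (u / l) ^ (1 / (b g))`. -/
def scaleStar (l b g u : ℝ) : ℝ :=
  b * g * u * scaleFun ((u / l) ^ (1 / (b * g))) * (u / l) ^ (-(1 / (b * g)))

/-- The set `J` of indices `j` with `bet j = max_i bet i`. -/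
def maxIdx (bet : Fin d → ℝ) : Set (Fin d) := {j | bet j = ⨆ i, bet i}

end LogGaussian

end

/-!
The estimator is unbiased because, by independence of the stratification index, its mean is
`∑ i, E[Z i] = ∑ i, P(S > u, X i = M)`. The law of `B N` depends only on `B Bᵀ`
(`map_gaussVec_eq`), so every term may be computed with the common factor `A`; ties between the
risks are null events since `A` is non-singular, and the sum is `P(S > u)`
(`sum_measureReal_maxEvent`).

Write `p i = P(X i > u)`. The second moment is `(∑ p) * ∑ i, E[(Z i)²] / p i`
(`stratified_moments`). By Jensen its ratio to `α²` is at least one, and the upper bound rests on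
two facts, combined in `stratified_ratio_le`.

* For `i` with maximal `bet i`, the estimator `Z i` is close to the constant `p i`
  (`eventually_moments_of_mem_maxIdx`). Given `N_{-i}`, the risk `X j` is
  `lam j * exp (bet j * g * (σ i j * N i + R j))` with `R j` independent of `N i` and of variance
  `1 - σ i j ^ 2`. Always `Z i ≤ P(X i > u / d)`, which is `p i` times at most a power of `u`;
  outside an event whose probability is a smaller power of `u`, every `R j` is below
  `√(1 - σ i j ^ 2) * √(2 K log u)`, and the condition on the correlations says that, for `X i` near `u`,
  the risk `X j` is then at most a small multiple of `e*`, the scale on which the tail of `X i`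
  varies (`eventually_othersBelow`). There
  `Z i ≤ P(X i > u - d ε e*) ≤ (1 + o(1)) p i` (`lt_of_mem_maxEvent_of_mem_goodEvent`), and on the
  same event `X i > u` already forces `X i = M` (`mem_maxEvent_of_mem_goodEvent`), so that
  `E[Z i] ≥ (1 - o(1)) p i`.
* The other indices are negligible: their `p i` is smaller than the largest one by more than any
  power of `u` (`eventually_moments_of_notMem_maxIdx`).

The normal tail enters only through two shift inequalities, `gaussTail_add_le` and
`gaussTail_sub_le`.
-/

noncomputable section

namespace LogGaussian

/-! ### Standard normal tails -/

/-- The tail `P(N > a)` of a standard normal random variable. -/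
def gaussTail (a : ℝ) : ℝ := (gaussianReal 0 1).real (Set.Ioi a)

lemma gaussTail_eq_integral (a : ℝ) :
    gaussTail a = ∫ x in Set.Ioi a, gaussianPDFReal 0 1 x := by
  rw [gaussTail, measureReal_def, gaussianReal_apply_eq_integral _ one_ne_zero,
    ENNReal.toReal_ofReal]
  exact setIntegral_nonneg measurableSet_Ioi fun x _ => gaussianPDFReal_nonneg _ _ _

lemma gaussTail_pos (a : ℝ) : 0 < gaussTail a := by
  rw [gaussTail, measureReal_def, ENNReal.toReal_pos_iff]
  refine ⟨pos_iff_ne_zero.mpr fun h => ?_, measure_lt_top _ _⟩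
  have := gaussianReal_absolutelyContinuous' 0 one_ne_zero h
  simp at this

lemma gaussTail_le_one (a : ℝ) : gaussTail a ≤ 1 := measureReal_le_one

lemma gaussianPDFReal_add_right (x s : ℝ) :
    gaussianPDFReal 0 1 (x + s) = gaussianPDFReal 0 1 x * Real.exp (-(x * s) - s ^ 2 / 2) := by
  simp only [gaussianPDFReal]
  rw [mul_assoc _ (Real.exp _), ← Real.exp_add]
  congr 2
  simp
  ring

lemma gaussianPDFReal_anti {x y : ℝ} (hx : 0 ≤ x) (hxy : x ≤ y) :
    gaussianPDFReal 0 1 y ≤ gaussianPDFReal 0 1 x := by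
  have h := gaussianPDFReal_add_right x (y - x)
  rw [add_sub_cancel] at h
  rw [h]
  refine mul_le_of_le_one_right (gaussianPDFReal_nonneg _ _ _) (Real.exp_le_one_iff.mpr ?_)
  nlinarith [mul_nonneg hx (sub_nonneg.mpr hxy), sq_nonneg (y - x)]

/-- The normal tail decays at least like `exp (-a s - s² / 2)` over a step of length `s`. -/
lemma gaussTail_add_le (a : ℝ) {s : ℝ} (hs : 0 ≤ s) :
    gaussTail (a + s) ≤ Real.exp (-(a * s) - s ^ 2 / 2) * gaussTail a := by
  have hint := integrable_gaussianPDFReal 0 1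
  have hshift := (measurePreserving_add_right volume s).setIntegral_preimage_emb
    (measurableEmbedding_addRight s) (gaussianPDFReal 0 1) (Set.Ioi (a + s))
  rw [Set.preimage_add_const_Ioi, add_sub_cancel_right] at hshift
  rw [gaussTail_eq_integral, gaussTail_eq_integral, ← hshift, ← integral_const_mul]
  refine setIntegral_mono_on (hint.comp_add_right s).integrableOn
    (hint.const_mul _).integrableOn measurableSet_Ioi fun x hx => ?_
  rw [gaussianPDFReal_add_right, mul_comm]
  gcongr
  · exact gaussianPDFReal_nonneg _ _ _
  · exact le_of_lt hx

lemma gaussTail_le_exp {r : ℝ} (hr : 0 ≤ r) : gaussTail r ≤ Real.exp (-(r ^ 2 / 2)) := by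
  have h := gaussTail_add_le 0 hr
  rw [zero_add, zero_mul, neg_zero, zero_sub] at h
  exact h.trans (mul_le_of_le_one_right (Real.exp_pos _).le (gaussTail_le_one 0))

lemma gaussTail_eq_setIntegral_add {a b : ℝ} (h : a ≤ b) :
    gaussTail a = (∫ x in Set.Ioc a b, gaussianPDFReal 0 1 x) + gaussTail b := by
  rw [gaussTail_eq_integral, gaussTail_eq_integral, ← Set.Ioc_union_Ioi_eq_Ioi h,
    setIntegral_union (Set.Ioc_disjoint_Ioi le_rfl) measurableSet_Ioi
      (integrable_gaussianPDFReal 0 1).integrableOn (integrable_gaussianPDFReal 0 1).integrableOn]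

/-- A crude lower Mills bound, from the mass of `(a, a + 1 / a]` alone. -/
lemma gaussianPDFReal_le_mul_gaussTail {a : ℝ} (ha : 1 ≤ a) :
    gaussianPDFReal 0 1 a ≤ a * Real.exp 2 * gaussTail a := by
  have ha0 : 0 < a := by linarith
  have h1 : gaussianPDFReal 0 1 (a + 1 / a) * (1 / a) ≤ gaussTail a := by
    have hle : a ≤ a + 1 / a := le_add_of_nonneg_right (by positivity)
    rw [gaussTail_eq_setIntegral_add hle]
    have h2 : gaussianPDFReal 0 1 (a + 1 / a) * (1 / a)
        ≤ ∫ x in Set.Ioc a (a + 1 / a), gaussianPDFReal 0 1 x := by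
      have h3 := setIntegral_mono_on (μ := volume) (s := Set.Ioc a (a + 1 / a))
        (f := fun _ => gaussianPDFReal 0 1 (a + 1 / a)) (g := gaussianPDFReal 0 1)
        (integrableOn_const (by simp)) (integrable_gaussianPDFReal 0 1).integrableOn
        measurableSet_Ioc (fun x hx => gaussianPDFReal_anti (by linarith [hx.1]) hx.2)
      refine le_trans (le_of_eq ?_) h3
      rw [setIntegral_const, smul_eq_mul, Real.volume_real_Ioc_of_le hle]
      ring
    linarith [gaussTail_pos (a + 1 / a)]
  have h4 : gaussianPDFReal 0 1 a * Real.exp (-2) ≤ gaussianPDFReal 0 1 (a + 1 / a) := by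
    rw [gaussianPDFReal_add_right]
    gcongr
    · exact gaussianPDFReal_nonneg _ _ _
    · have h5 : a * (1 / a) = 1 := by field_simp
      have h6 : 1 / a ≤ 1 := by rw [div_le_one ha0]; exact ha
      have h7 : (1 / a) ^ 2 ≤ 1 := pow_le_one₀ (by positivity) h6
      rw [h5]
      linarith
  calc gaussianPDFReal 0 1 a
      = a * Real.exp 2 * (gaussianPDFReal 0 1 a * Real.exp (-2) * (1 / a)) := by
        rw [Real.exp_neg]; field_simp
    _ ≤ a * Real.exp 2 * gaussTail a := by
        gcongr
        exact (mul_le_mul_of_nonneg_right h4 (by positivity)).trans h1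

/-- Moving the threshold down by `s` raises the normal tail by a factor close to `1` if `s a` is
small, and by a factor at most of order `exp (2 s a)` in general. -/
lemma gaussTail_sub_le {a s : ℝ} (ha : 1 ≤ a) (hs : 0 ≤ s) (hsa : s ≤ a) :
    gaussTail (a - s) ≤ (1 + s * a * Real.exp (s * a + 2)) * gaussTail a := by
  rw [gaussTail_eq_setIntegral_add (show a - s ≤ a by linarith)]
  have h3 : ∫ x in Set.Ioc (a - s) a, gaussianPDFReal 0 1 x ≤ s * gaussianPDFReal 0 1 (a - s) := by
    have h3 := setIntegral_mono_on (μ := volume) (s := Set.Ioc (a - s) a)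
      (g := fun _ => gaussianPDFReal 0 1 (a - s)) (f := gaussianPDFReal 0 1)
      (integrable_gaussianPDFReal 0 1).integrableOn (integrableOn_const (by simp))
      measurableSet_Ioc (fun x hx => gaussianPDFReal_anti (by linarith) hx.1.le)
    refine h3.trans (le_of_eq ?_)
    rw [setIntegral_const, smul_eq_mul, Real.volume_real_Ioc_of_le (by linarith)]
    ring
  have h4 : gaussianPDFReal 0 1 (a - s) ≤ gaussianPDFReal 0 1 a * Real.exp (s * a) := by
    rw [sub_eq_add_neg, gaussianPDFReal_add_right]
    gcongr
    · exact gaussianPDFReal_nonneg _ _ _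
    · nlinarith [sq_nonneg s]
  have h5 := gaussianPDFReal_le_mul_gaussTail ha
  have h6 : s * gaussianPDFReal 0 1 (a - s) ≤ s * a * Real.exp (s * a + 2) * gaussTail a := by
    calc s * gaussianPDFReal 0 1 (a - s)
        ≤ s * ((a * Real.exp 2 * gaussTail a) * Real.exp (s * a)) := by
          gcongr
          exact h4.trans (by gcongr)
      _ = _ := by rw [Real.exp_add]; ring
  linarith

/-! ### Linear combinations of independent normals -/

section LinearCombination

variable {d : ℕ} {Ω : Type*} [MeasurableSpace Ω] {μ : Measure Ω} [IsProbabilityMeasure μ]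
  {N : Fin d → Ω → ℝ}

lemma map_linearCombination (hNm : ∀ i, Measurable (N i))
    (hN : ∀ i, μ.map (N i) = gaussianReal 0 1) (hNind : iIndepFun N μ) (c : Fin d → ℝ) :
    μ.map (fun ω => ∑ k, c k * N k ω) = gaussianReal 0 (∑ k, c k ^ 2).toNNReal := by
  have : IsProbabilityMeasure (μ.map (fun ω => ∑ k, c k * N k ω)) :=
    Measure.isProbabilityMeasure_map (by fun_prop)
  refine Measure.ext_of_charFun (funext fun t => ?_)
  have hind : iIndepFun (fun k ω => c k * N k ω) μ :=
    hNind.comp (fun k x => c k * x) fun k => by fun_prop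
  rw [hind.charFun_map_fun_sum_eq_prod (fun k => by fun_prop), Finset.prod_apply]
  have h1 : ∀ k, charFun (μ.map (fun ω => c k * N k ω)) t
      = Complex.exp (-((c k ^ 2 : ℝ) * t ^ 2 / 2 : ℂ)) := by
    intro k
    rw [charFun_map_mul_comp (by fun_prop), hN k, charFun_gaussianReal]
    congr 1
    push_cast
    ring
  simp_rw [h1]
  rw [← Complex.exp_sum, charFun_gaussianReal]
  congr 1
  rw [Finset.sum_neg_distrib, ← Finset.sum_div, ← Finset.sum_mul]
  have : ((Real.toNNReal (∑ k, c k ^ 2) : ℝ)) = ∑ k, c k ^ 2 :=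
    Real.coe_toNNReal _ (Finset.sum_nonneg fun _ _ => sq_nonneg _)
  rw [this]
  push_cast
  ring

/-- The Gaussian tail bound for a linear combination with variance `s²`; `s = 0` is allowed. -/
lemma measureReal_linearCombination_gt_le (hNm : ∀ i, Measurable (N i))
    (hN : ∀ i, μ.map (N i) = gaussianReal 0 1) (hNind : iIndepFun N μ) (c : Fin d → ℝ) {s r : ℝ}
    (hs : 0 ≤ s) (hcs : ∑ k, c k ^ 2 = s ^ 2) :
    μ.real {ω | s * r < ∑ k, c k * N k ω} ≤ gaussTail r := by
  have h1 : μ.real {ω | s * r < ∑ k, c k * N k ω}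
      = (μ.map (fun ω => ∑ k, c k * N k ω)).real (Set.Ioi (s * r)) := by
    rw [map_measureReal_apply (by fun_prop) measurableSet_Ioi]
    rfl
  have h2 : gaussianReal 0 (∑ k, c k ^ 2).toNNReal = (gaussianReal 0 1).map (s * ·) := by
    rw [gaussianReal_map_const_mul, mul_zero, mul_one, hcs]
    congr 1
    ext
    simp [sq_nonneg]
  rw [h1, map_linearCombination hNm hN hNind, h2,
    map_measureReal_apply (by fun_prop) measurableSet_Ioi]
  refine measureReal_mono fun x hx => ?_
  exact lt_of_mul_lt_mul_left hx hs

/-- The law of `B N` depends on `B` through `B Bᵀ` only. -/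
lemma map_gaussVec_eq (hNm : ∀ i, Measurable (N i))
    (hN : ∀ i, μ.map (N i) = gaussianReal 0 1) (hNind : iIndepFun N μ)
    {A B : Matrix (Fin d) (Fin d) ℝ} (hAB : corr A = corr B) :
    μ.map (fun ω i => gaussVec A N i ω) = μ.map (fun ω i => gaussVec B N i ω) := by
  have hmeas : ∀ A : Matrix (Fin d) (Fin d) ℝ, Measurable (fun ω i => gaussVec A N i ω) := by
    intro A
    simp only [gaussVec, Matrix.mulVec, dotProduct]
    fun_prop
  have key : ∀ (A : Matrix (Fin d) (Fin d) ℝ) (L : StrongDual ℝ (Fin d → ℝ)),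
      (μ.map (fun ω i => gaussVec A N i ω)).map L
        = gaussianReal 0
          (∑ i, ∑ j, L (Pi.single i 1) * L (Pi.single j 1) * corr A i j).toNNReal := by
    intro A L
    rw [Measure.map_map (by fun_prop) (hmeas A)]
    have h1 : (L ∘ fun ω i => gaussVec A N i ω)
        = fun ω => ∑ k, (∑ i, L (Pi.single i 1) * A i k) * N k ω := by
      funext ω
      have : L (fun i => gaussVec A N i ω)
          = ∑ i, gaussVec A N i ω * L (Pi.single i 1) := by
        conv_lhs => rw [← Finset.univ_sum_single (fun i => gaussVec A N i ω)]
        rw [map_sum]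
        refine Finset.sum_congr rfl fun i _ => ?_
        rw [← smul_eq_mul, ← map_smul, ← Pi.single_smul, smul_eq_mul, mul_one]
      rw [Function.comp_apply, this]
      simp only [gaussVec, Matrix.mulVec, dotProduct, Finset.sum_mul]
      rw [Finset.sum_comm]
      refine Finset.sum_congr rfl fun k _ => Finset.sum_congr rfl fun i _ => by ring
    rw [h1, map_linearCombination hNm hN hNind]
    congr 2
    simp only [sq, Finset.sum_mul_sum]
    simp only [corr, Matrix.mul_apply, Matrix.transpose_apply, Finset.mul_sum]
    rw [Finset.sum_comm]
    refine Finset.sum_congr rfl fun i _ => ?_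
    rw [Finset.sum_comm]
    refine Finset.sum_congr rfl fun j _ => Finset.sum_congr rfl fun k _ => by ring
  have : ∀ A : Matrix (Fin d) (Fin d) ℝ,
      IsProbabilityMeasure (μ.map (fun ω i => gaussVec A N i ω)) :=
    fun A => Measure.isProbabilityMeasure_map (hmeas A).aemeasurable
  refine Measure.ext_of_charFunDual (funext fun L => ?_)
  rw [charFunDual_eq_charFun_map_one, charFunDual_eq_charFun_map_one, key A, key B, hAB]

end LinearCombination

/-! ### Factors of the correlation matrix -/

section Factor

variable {d : ℕ} {Ω : Type*} {N : Fin d → Ω → ℝ} {lam bet : Fin d → ℝ} {g u : ℝ}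
  {A B : Matrix (Fin d) (Fin d) ℝ} {i : Fin d}

/-- The threshold `log (u / l) / (b g)` that a standard normal `N` has to exceed in order that
`l * exp (b g N) > u`. -/
def threshold (l b g u : ℝ) : ℝ := Real.log (u / l) / (b * g)

/-- The part of `(B N) j` that does not involve `N i`. -/
def residual (B : Matrix (Fin d) (Fin d) ℝ) (N : Fin d → Ω → ℝ) (i j : Fin d) (ω : Ω) : ℝ :=
  ∑ k, (if k = i then 0 else B j k) * N k ω

/-- The event `{S > u, X i = M}`. -/
def maxEvent (lam bet : Fin d → ℝ) (g : ℝ) (B : Matrix (Fin d) (Fin d) ℝ)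
    (N : Fin d → Ω → ℝ) (u : ℝ) (i : Fin d) : Set Ω :=
  {ω | u < aggRisk lam bet g B N ω ∧ risk lam bet g B N i ω = maxRisk lam bet g B N ω}

lemma sum_sq_eq_corr (A : Matrix (Fin d) (Fin d) ℝ) (i : Fin d) :
    ∑ k, A i k ^ 2 = corr A i i := by
  rw [corr, Matrix.mul_apply]
  exact Finset.sum_congr rfl fun k _ => by rw [Matrix.transpose_apply, sq]

lemma IsFactorAt.apply_eq_corr (hB : IsFactorAt (corr A) i B) (j : Fin d) :
    B j i = corr A i j := by
  rw [← hB.1, Matrix.mul_apply]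
  simp [hB.2]

lemma IsFactorAt.sum_residual_sq (hB : IsFactorAt (corr A) i B) {j : Fin d}
    (hj : corr A j j = 1) :
    ∑ k, (if k = i then 0 else B j k) ^ 2 = 1 - corr A i j ^ 2 := by
  have h1 : ∑ k, B j k ^ 2 = 1 := by
    rw [sum_sq_eq_corr, corr, hB.1, hj]
  rw [← hB.apply_eq_corr j, ← h1, eq_sub_iff_add_eq, ← Finset.add_sum_erase _ _ (Finset.mem_univ i),
    ← Finset.add_sum_erase (a := i) _ (fun k => B j k ^ 2) (Finset.mem_univ i)]
  rw [Finset.sum_congr rfl (g := fun k => B j k ^ 2) fun k hk => by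
    rw [if_neg (Finset.ne_of_mem_erase hk)]]
  simp

/-- The regression of `(B N) j` on `N i`: the residual is a function of `N_{-i}`. -/
lemma IsFactorAt.gaussVec_eq (hB : IsFactorAt (corr A) i B) (j : Fin d) (ω : Ω) :
    gaussVec B N j ω = corr A i j * N i ω + residual B N i j ω := by
  have h1 : gaussVec B N j ω = ∑ k, B j k * N k ω := rfl
  have h2 : ∑ k ∈ Finset.univ.erase i, (if k = i then 0 else B j k) * N k ω
      = ∑ k ∈ Finset.univ.erase i, B j k * N k ω :=
    Finset.sum_congr rfl fun k hk => by rw [if_neg (Finset.ne_of_mem_erase hk)]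
  rw [← hB.apply_eq_corr j, h1, residual, ← Finset.add_sum_erase _ _ (Finset.mem_univ i),
    ← Finset.add_sum_erase (a := i) _ (fun k => (if k = i then 0 else B j k) * N k ω)
      (Finset.mem_univ i), h2]
  simp

lemma IsFactorAt.gaussVec_self (hB : IsFactorAt (corr A) i B) (ω : Ω) :
    gaussVec B N i ω = N i ω := by
  rw [gaussVec, Matrix.mulVec, dotProduct]
  simp [hB.2]

lemma measurable_residual (B : Matrix (Fin d) (Fin d) ℝ) (N : Fin d → Ω → ℝ) (i j : Fin d) :
    Measurable[sigmaExcept N i] (residual B N i j) := by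
  refine Finset.measurable_fun_sum _ fun k _ => ?_
  by_cases hk : k = i
  · simp only [hk, if_true, zero_mul]
    exact @measurable_const _ _ _ (sigmaExcept N i) _
  · have h : Measurable[sigmaExcept N i] fun (ω : Ω) (k : {k : Fin d // k ≠ i}) => N k ω :=
      comap_measurable _
    have h2 : Measurable[sigmaExcept N i] (N k) :=
      (measurable_pi_apply (⟨k, hk⟩ : {k : Fin d // k ≠ i})).comp h
    exact h2.const_mul _

lemma sigmaExcept_le_comap (N : Fin d → Ω → ℝ) (i : Fin d) :
    sigmaExcept N i ≤ MeasurableSpace.comap (fun ω k => N k ω) inferInstance := by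
  rintro _ ⟨s, hs, rfl⟩
  refine ⟨(fun (f : Fin d → ℝ) (k : {k : Fin d // k ≠ i}) => f k) ⁻¹' s, ?_, rfl⟩
  exact (by fun_prop : Measurable fun (f : Fin d → ℝ) (k : {k : Fin d // k ≠ i}) => f k) hs

lemma risk_le_maxRisk (j : Fin d) (ω : Ω) :
    risk lam bet g A N j ω ≤ maxRisk lam bet g A N ω :=
  le_ciSup (f := fun j => risk lam bet g A N j ω) (Set.finite_range _).bddAbove j

lemma lt_mul_exp_iff {l b g u x : ℝ} (hl : 0 < l) (hb : 0 < b) (hg : 0 < g) (hu : 0 < u) :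
    u < l * Real.exp (b * g * x) ↔ threshold l b g u < x := by
  rw [threshold, div_lt_iff₀ (by positivity), Real.log_lt_iff_lt_exp (by positivity),
    div_lt_iff₀ hl, mul_comm, mul_comm x]

lemma indep_sigmaExcept {Ω : Type*} [MeasurableSpace Ω] {μ : Measure Ω} {N : Fin d → Ω → ℝ}
    (hNm : ∀ i, Measurable (N i)) (hNind : iIndepFun N μ) (i : Fin d) :
    Indep (MeasurableSpace.comap (N i) inferInstance) (sigmaExcept N i) μ := by
  have h := hNind.indepFun_finset {i} (Finset.univ.erase i) (by simp) hNm
  exact h.comp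
    (φ := fun f : ({i} : Finset (Fin d)) → ℝ => f ⟨i, Finset.mem_singleton_self i⟩)
    (ψ := fun (f : Finset.univ.erase i → ℝ) (k : {k : Fin d // k ≠ i}) => f ⟨k.1, by simp [k.2]⟩)
    (by fun_prop) (by fun_prop)

end Factor

/-! ### Which risk is the largest -/

section MaxEvent

variable {d : ℕ} {Ω : Type*} [MeasurableSpace Ω] {μ : Measure Ω} [IsProbabilityMeasure μ]
  {N : Fin d → Ω → ℝ} {lam bet : Fin d → ℝ} {g u : ℝ} {A B : Matrix (Fin d) (Fin d) ℝ} {i : Fin d}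

lemma sigmaExcept_le (hNm : ∀ i, Measurable (N i)) (i : Fin d) :
    sigmaExcept N i ≤ ‹MeasurableSpace Ω› :=
  Measurable.comap_le (by fun_prop)

lemma measurable_gaussVec (hNm : ∀ i, Measurable (N i)) (A : Matrix (Fin d) (Fin d) ℝ)
    (i : Fin d) : Measurable (gaussVec A N i) := by
  unfold gaussVec Matrix.mulVec dotProduct
  fun_prop

lemma measurable_risk (hNm : ∀ i, Measurable (N i)) (i : Fin d) :
    Measurable (risk lam bet g A N i) := by
  have := measurable_gaussVec hNm A i
  unfold risk
  fun_prop

lemma measurableSet_maxEvent (hNm : ∀ i, Measurable (N i)) (i : Fin d) :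
    MeasurableSet (maxEvent lam bet g A N u i) := by
  have h := fun i => measurable_risk (lam := lam) (bet := bet) (g := g) (A := A) hNm i
  have h1 : Measurable (aggRisk lam bet g A N) := by
    unfold aggRisk
    fun_prop
  have h2 : Measurable (maxRisk lam bet g A N) := Measurable.iSup h
  exact (measurableSet_lt measurable_const h1).inter (measurableSet_eq_fun (h i) h2)

lemma margTail_eq_gaussTail (hNm : ∀ i, Measurable (N i))
    (hN : ∀ i, μ.map (N i) = gaussianReal 0 1) (hNind : iIndepFun N μ)
    (hlam : ∀ i, 0 < lam i) (hbet : ∀ i, 0 < bet i) (hg : 0 < g) (hu : 0 < u)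
    (hA : corr A i i = 1) :
    margTail μ lam bet g A N u i = gaussTail (threshold (lam i) (bet i) g u) := by
  have h1 := map_linearCombination hNm hN hNind (A i)
  rw [sum_sq_eq_corr, hA, Real.toNNReal_one] at h1
  rw [gaussTail, ← h1, map_measureReal_apply (by fun_prop) measurableSet_Ioi, margTail]
  congr 1
  ext ω
  exact lt_mul_exp_iff (hlam i) (hbet i) hg hu

lemma measureReal_maxEvent_congr (hNm : ∀ i, Measurable (N i))
    (hN : ∀ i, μ.map (N i) = gaussianReal 0 1) (hNind : iIndepFun N μ) (hAB : corr A = corr B)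
    (i : Fin d) :
    μ.real (maxEvent lam bet g A N u i) = μ.real (maxEvent lam bet g B N u i) := by
  have hm : ∀ A : Matrix (Fin d) (Fin d) ℝ, Measurable (fun ω i => gaussVec A N i ω) :=
    fun A => measurable_pi_lambda _ fun i => measurable_gaussVec hNm A i
  -- the event read off from the values `y` of the Gaussian vector
  let X : (Fin d → ℝ) → Fin d → ℝ := fun y i => lam i * Real.exp (bet i * g * y i)
  let s : Set (Fin d → ℝ) := {y | u < ∑ i, X y i ∧ X y i = ⨆ j, X y j}
  have hX : ∀ i, Measurable fun y => X y i := fun i => by fun_prop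
  have hs : MeasurableSet s :=
    (measurableSet_lt measurable_const (Finset.measurable_fun_sum _ fun i _ => hX i)).inter
      (measurableSet_eq_fun (hX i) (Measurable.iSup hX))
  have key : ∀ A : Matrix (Fin d) (Fin d) ℝ, μ.real (maxEvent lam bet g A N u i)
      = (μ.map (fun ω i => gaussVec A N i ω)).real s := by
    intro A
    rw [map_measureReal_apply (hm A) hs]
    rfl
  rw [key A, key B, map_gaussVec_eq hNm hN hNind hAB]

/-- Ties between two risks have probability zero, because `A` is non-singular. -/
lemma measure_risk_eq_risk (hNm : ∀ i, Measurable (N i))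
    (hN : ∀ i, μ.map (N i) = gaussianReal 0 1) (hNind : iIndepFun N μ)
    (hlam : ∀ i, 0 < lam i) (hbet : ∀ i, 0 < bet i) (hg : 0 < g) (hA : A.det ≠ 0)
    {i j : Fin d} (hij : i ≠ j) :
    μ {ω | risk lam bet g A N i ω = risk lam bet g A N j ω} = 0 := by
  -- a tie forces the normal variable `∑ k, c k * N k`, of positive variance, to a single value
  let v : Fin d → ℝ := Pi.single i (bet i * g) - Pi.single j (bet j * g)
  let c : Fin d → ℝ := Matrix.vecMul v A
  have hc : ∑ k, c k ^ 2 ≠ 0 := by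
    intro h0
    have h1 : c = 0 := by
      funext k
      have := (Finset.sum_eq_zero_iff_of_nonneg fun k _ => sq_nonneg (c k)).mp h0 k
        (Finset.mem_univ k)
      exact pow_eq_zero_iff two_ne_zero |>.mp this
    have h2 : v = 0 := Matrix.eq_zero_of_vecMul_eq_zero hA h1
    have h3 : v i = bet i * g := by simp [v, Pi.single_eq_of_ne hij]
    rw [h2] at h3
    exact absurd h3 (by have := mul_pos (hbet i) hg; simp; exact ⟨(hbet i).ne', hg.ne'⟩)
  have hc' : ∀ ω, ∑ k, c k * N k ω = bet i * g * gaussVec A N i ω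
      - bet j * g * gaussVec A N j ω := by
    intro ω
    change Matrix.vecMul v A ⬝ᵥ (fun k => N k ω) = _
    rw [← Matrix.dotProduct_mulVec]
    simp [v, gaussVec, sub_dotProduct]
  have hsub : {ω | risk lam bet g A N i ω = risk lam bet g A N j ω}
      ⊆ (fun ω => ∑ k, c k * N k ω) ⁻¹' {Real.log (lam j) - Real.log (lam i)} := by
    intro ω hω
    have h1 : lam i * Real.exp (bet i * g * gaussVec A N i ω)
        = lam j * Real.exp (bet j * g * gaussVec A N j ω) := hω
    have h2 := congrArg Real.log h1
    rw [Real.log_mul (hlam i).ne' (Real.exp_ne_zero _), Real.log_mul (hlam j).ne'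
      (Real.exp_ne_zero _), Real.log_exp, Real.log_exp] at h2
    rw [Set.mem_preimage, hc', Set.mem_singleton_iff]
    linarith
  refine measure_mono_null hsub ?_
  rw [← Measure.map_apply (by fun_prop) (measurableSet_singleton _),
    map_linearCombination hNm hN hNind]
  have hv : (∑ k, c k ^ 2).toNNReal ≠ 0 := by
    rw [Ne, Real.toNNReal_eq_zero, not_le]
    exact lt_of_le_of_ne (Finset.sum_nonneg fun k _ => sq_nonneg _) hc.symm
  have := nullSingletonClass_gaussianReal (μ := 0) hv
  exact measure_singleton _

/-- The probability of `S > u` splits according to the index of the largest risk, and each part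
may be computed with a factor of its own. -/
lemma sum_measureReal_maxEvent (hd : 1 ≤ d) (hNm : ∀ i, Measurable (N i))
    (hN : ∀ i, μ.map (N i) = gaussianReal 0 1) (hNind : iIndepFun N μ)
    (hlam : ∀ i, 0 < lam i) (hbet : ∀ i, 0 < bet i) (hg : 0 < g) (hA : A.det ≠ 0)
    {B : Fin d → Matrix (Fin d) (Fin d) ℝ} (hB : ∀ j, IsFactorAt (corr A) j (B j)) :
    ∑ i, μ.real (maxEvent lam bet g (B i) N u i) = tailProb μ lam bet g A N u := by
  have h1 : ∀ i, μ.real (maxEvent lam bet g (B i) N u i) = μ.real (maxEvent lam bet g A N u i) :=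
    fun i => measureReal_maxEvent_congr hNm hN hNind (hB i).1 i
  simp_rw [h1]
  have hU : {ω | u < aggRisk lam bet g A N ω} = ⋃ i, maxEvent lam bet g A N u i := by
    have : Nonempty (Fin d) := ⟨⟨0, hd⟩⟩
    ext ω
    obtain ⟨i, hi⟩ := exists_eq_ciSup_of_finite (f := fun i => risk lam bet g A N i ω)
    simp only [Set.mem_ofPred_eq, Set.mem_iUnion]
    exact ⟨fun h => ⟨i, h, hi⟩, fun ⟨_, h⟩ => h.1⟩
  rw [tailProb, hU, measureReal_def, measure_iUnion₀, tsum_fintype, ENNReal.toReal_sum]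
  · rfl
  · exact fun _ _ => measure_ne_top _ _
  · intro i j hij
    refine measure_mono_null ?_
      (measure_risk_eq_risk (lam := lam) (bet := bet) hNm hN hNind hlam hbet hg hA hij)
    exact fun ω hω => hω.1.2.trans hω.2.2.symm
  · exact fun i => (measurableSet_maxEvent hNm i).nullMeasurableSet

end MaxEvent

/-! ### The conditional estimator -/

section CondEst

variable {d : ℕ} {Ω : Type*} [MeasurableSpace Ω] {μ : Measure Ω}
  {N : Fin d → Ω → ℝ} {lam bet : Fin d → ℝ} {g u : ℝ} {B : Matrix (Fin d) (Fin d) ℝ} {i : Fin d}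

lemma condEst_def : condEst μ lam bet g B N u i
    = μ[(maxEvent lam bet g B N u i).indicator fun _ => (1 : ℝ) | sigmaExcept N i] := rfl

lemma stronglyMeasurable_condEst :
    StronglyMeasurable[sigmaExcept N i] (condEst μ lam bet g B N u i) :=
  stronglyMeasurable_condExp

lemma integrable_condEst : Integrable (condEst μ lam bet g B N u i) μ := integrable_condExp

lemma condEst_nonneg : ∀ᵐ ω ∂μ, 0 ≤ condEst μ lam bet g B N u i ω :=
  condExp_nonneg (Eventually.of_forall fun _ => Set.indicator_nonneg (fun _ _ => zero_le_one) _)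

variable [IsProbabilityMeasure μ]

lemma integral_condEst (hNm : ∀ i, Measurable (N i)) :
    ∫ ω, condEst μ lam bet g B N u i ω ∂μ = μ.real (maxEvent lam bet g B N u i) := by
  rw [condEst_def, integral_condExp (sigmaExcept_le hNm i)]
  exact integral_indicator_one (measurableSet_maxEvent hNm i)

/-- If, on a `σ(N_{-i})`-measurable event `G`, the event `{S > u, X i = M}` forces `N i > w`, then
the estimator is at most `P(N i > w)` on `G`: this is the independence of `N i` and `N_{-i}`. -/
lemma condEst_le_gaussTail (hNm : ∀ i, Measurable (N i))
    (hN : ∀ i, μ.map (N i) = gaussianReal 0 1) (hNind : iIndepFun N μ) {G : Set Ω}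
    (hG : MeasurableSet[sigmaExcept N i] G) {w : ℝ}
    (hw : ∀ ω ∈ maxEvent lam bet g B N u i, ω ∈ G → w < N i ω) :
    ∀ᵐ ω ∂μ, ω ∈ G → condEst μ lam bet g B N u i ω ≤ gaussTail w := by
  have hm := sigmaExcept_le hNm i
  have hE := measurableSet_maxEvent (lam := lam) (bet := bet) (g := g) (A := B) (u := u) hNm i
  have hF : MeasurableSet[MeasurableSpace.comap (N i) inferInstance] (N i ⁻¹' Set.Ioi w) :=
    ⟨Set.Ioi w, measurableSet_Ioi, rfl⟩
  have hF' : MeasurableSet (N i ⁻¹' Set.Ioi w) := hNm i measurableSet_Ioi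
  have hEint : Integrable ((maxEvent lam bet g B N u i).indicator fun _ => (1 : ℝ)) μ :=
    (integrable_const _).indicator hE
  have h1 := condExp_indicator (m := sigmaExcept N i) hEint hG
  have h2 : μ[G.indicator ((maxEvent lam bet g B N u i).indicator fun _ => (1 : ℝ)) |
      sigmaExcept N i]
      ≤ᵐ[μ] μ[(N i ⁻¹' Set.Ioi w).indicator fun _ => (1 : ℝ) | sigmaExcept N i] := by
    refine condExp_mono (hEint.indicator (hm _ hG)) ((integrable_const _).indicator hF')
      (Eventually.of_forall fun ω => ?_)
    rw [Set.indicator_indicator]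
    exact Set.indicator_le_indicator_of_subset (fun ω hω => hw ω hω.2 hω.1)
      (fun _ => zero_le_one) ω
  have h3 := condExp_indep_eq (μ := μ) (hNm i).comap_le hm
    (f := (N i ⁻¹' Set.Ioi w).indicator fun _ => (1 : ℝ))
    (stronglyMeasurable_const.indicator hF) (indep_sigmaExcept hNm hNind i)
  filter_upwards [h1, h2, h3] with ω h1 h2 h3 hω
  rw [h1, Set.indicator_of_mem hω, h3] at h2
  refine h2.trans (le_of_eq ?_)
  rw [integral_indicator hF', setIntegral_const, smul_eq_mul, mul_one, gaussTail, ← hN i,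
    map_measureReal_apply (hNm i) measurableSet_Ioi]

lemma condEst_le_one (hNm : ∀ i, Measurable (N i)) :
    ∀ᵐ ω ∂μ, condEst μ lam bet g B N u i ω ≤ 1 := by
  have h := condExp_mono (m := sigmaExcept N i) (μ := μ)
    (f := (maxEvent lam bet g B N u i).indicator fun _ => (1 : ℝ)) (g := fun _ => (1 : ℝ))
    ((integrable_const _).indicator (measurableSet_maxEvent hNm i)) (integrable_const _)
    (Eventually.of_forall fun ω => Set.indicator_le_self' (fun _ _ => zero_le_one) ω)
  rwa [condExp_const (sigmaExcept_le hNm i)] at h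

end CondEst

/-! ### Stratification -/

/-- Mean and second moment of a stratified estimator: the index `I` is chosen with probability
`p i / ∑ p` independently of `Z i`, and the chosen `Z i` is reweighted. -/
lemma stratified_moments {d : ℕ} {Ω : Type*} [MeasurableSpace Ω] {μ : Measure Ω}
    [IsProbabilityMeasure μ] {I : Ω → Fin d} (hI : Measurable I) {Z : Fin d → Ω → ℝ}
    (hZ : ∀ i, AEStronglyMeasurable (Z i) μ) (hZ1 : ∀ i, ∀ᵐ ω ∂μ, |Z i ω| ≤ 1)
    (hind : ∀ i, IndepFun I (Z i) μ) {p : Fin d → ℝ} (hp : ∀ i, 0 < p i)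
    (hIp : ∀ i, μ.real {ω | I ω = i} = p i / ∑ k, p k) :
    MemLp (fun ω => (∑ i, p i) * ∑ i, (if I ω = i then 1 else 0) * (Z i ω / p i)) 2 μ ∧
    ∫ ω, (∑ i, p i) * ∑ i, (if I ω = i then 1 else 0) * (Z i ω / p i) ∂μ = ∑ i, ∫ ω, Z i ω ∂μ ∧
    ∫ ω, ((∑ i, p i) * ∑ i, (if I ω = i then 1 else 0) * (Z i ω / p i)) ^ 2 ∂μ
      = (∑ i, p i) * ∑ i, (∫ ω, Z i ω ^ 2 ∂μ) / p i := by
  have hS : ∀ i : Fin d, MeasurableSet {ω | I ω = i} := fun i => hI (measurableSet_singleton i)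
  have hJ : ∀ i, Measurable fun ω => if I ω = i then (1 : ℝ) else 0 := fun i =>
    Measurable.ite (hS i) measurable_const measurable_const
  have hJint : ∀ i, ∫ ω, (if I ω = i then (1 : ℝ) else 0) ∂μ = p i / ∑ k, p k := by
    intro i
    rw [← hIp i, ← integral_indicator_one (hS i)]
    exact integral_congr_ae (Eventually.of_forall fun ω => by simp [Set.indicator_apply])
  have hPne : ∀ _ : Fin d, (∑ k, p k) ≠ 0 := fun i =>
    (Finset.sum_pos (fun k _ => hp k) ⟨i, Finset.mem_univ i⟩).ne'
  have hZi : ∀ i, Integrable (Z i) μ := fun i =>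
    Integrable.of_bound (hZ i) 1 ((hZ1 i).mono fun ω h => by rwa [Real.norm_eq_abs])
  have hZ2i : ∀ i, Integrable (fun ω => Z i ω ^ 2) μ := fun i =>
    Integrable.of_bound ((hZ i).pow 2) 1 ((hZ1 i).mono fun ω h => by
      rw [Real.norm_eq_abs, abs_pow]
      exact pow_le_one₀ (abs_nonneg _) h)
  have hbound : ∀ (f : Ω → ℝ) (i : Fin d), Integrable f μ →
      Integrable (fun ω => (if I ω = i then (1 : ℝ) else 0) * f ω) μ := fun f i hf =>
    hf.bdd_mul (c := 1) (hJ i).aestronglyMeasurable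
      (Eventually.of_forall fun ω => by split_ifs <;> simp)
  have hfac : ∀ (φ : ℝ → ℝ) (i : Fin d), Measurable φ →
      ∫ ω, (if I ω = i then (1 : ℝ) else 0) * φ (Z i ω) ∂μ
        = p i / (∑ k, p k) * ∫ ω, φ (Z i ω) ∂μ := by
    intro φ i hφ
    rw [← hJint i]
    refine IndepFun.integral_fun_mul_eq_mul_integral (X := fun ω => if I ω = i then (1 : ℝ) else 0)
      (Y := fun ω => φ (Z i ω)) ?_ (hJ i).aestronglyMeasurable
      (hφ.comp_aemeasurable (hZ i).aemeasurable).aestronglyMeasurable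
    exact (hind i).comp (φ := fun k => if k = i then (1 : ℝ) else 0) (ψ := φ)
      (measurable_of_finite _) hφ
  refine ⟨?_, ?_, ?_⟩
  · have hterm : ∀ i ∈ Finset.univ,
        MemLp (fun ω => (if I ω = i then (1 : ℝ) else 0) * (Z i ω / p i)) 2 μ := by
      intro i _
      refine MemLp.of_bound ((hJ i).aestronglyMeasurable.mul
        ((hZ i).aemeasurable.div_const _).aestronglyMeasurable) (1 / p i) ?_
      filter_upwards [hZ1 i] with ω h
      rw [norm_mul, Real.norm_eq_abs, Real.norm_eq_abs, abs_div, abs_of_pos (hp i)]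
      split_ifs
      · rw [abs_one, one_mul]
        exact div_le_div_of_nonneg_right h (hp i).le
      · rw [abs_zero, zero_mul]
        have := hp i
        positivity
    exact (memLp_finsetSum Finset.univ hterm).const_mul _
  · rw [integral_const_mul, integral_finsetSum _ fun i _ => hbound _ i ((hZi i).div_const _),
      Finset.mul_sum]
    refine Finset.sum_congr rfl fun i _ => ?_
    rw [hfac (fun x => x / p i) i (by fun_prop), integral_div]
    have := hPne i
    have := (hp i).ne'
    field_simp
  · have hsq : ∀ ω, ((∑ i, p i) * ∑ i, (if I ω = i then 1 else 0) * (Z i ω / p i)) ^ 2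
        = (∑ i, p i) ^ 2 * ∑ i, (if I ω = i then 1 else 0) * (Z i ω / p i) ^ 2 := by
      intro ω
      rw [mul_pow]
      simp
    simp_rw [hsq]
    rw [integral_const_mul, integral_finsetSum _ fun i _ => hbound _ i (by
      simp_rw [div_pow]
      exact (hZ2i i).div_const _), Finset.mul_sum, Finset.mul_sum]
    refine Finset.sum_congr rfl fun i _ => ?_
    rw [hfac (fun x => (x / p i) ^ 2) i (by fun_prop)]
    simp_rw [div_pow]
    rw [integral_div]
    have := hPne i
    have := (hp i).ne'
    field_simp

/-! ### The good event -/

section Pathwise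

variable {d : ℕ} {Ω : Type*} {N : Fin d → Ω → ℝ} {lam bet : Fin d → ℝ} {g u : ℝ}
  {A B : Matrix (Fin d) (Fin d) ℝ} {i : Fin d}

lemma corr_sq_le_one (hA : ∀ i, corr A i i = 1) (i j : Fin d) : corr A i j ^ 2 ≤ 1 := by
  have h := Finset.sum_mul_sq_le_sq_mul_sq Finset.univ (A i) (A j)
  rw [sum_sq_eq_corr, sum_sq_eq_corr, hA, hA, one_mul] at h
  exact h

lemma mul_exp_threshold {l b g u : ℝ} (hl : 0 < l) (hb : 0 < b) (hg : 0 < g) (hu : 0 < u) :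
    l * Real.exp (b * g * threshold l b g u) = u := by
  rw [threshold, mul_div_cancel₀ _ (by positivity), Real.exp_log (by positivity)]
  field_simp

/-- If `S > u` and `X i` is the largest risk, then `X i > u / d`. -/
lemma threshold_sub_lt_of_mem_maxEvent (hd : 1 ≤ d) (hlam : ∀ i, 0 < lam i)
    (hbet : ∀ i, 0 < bet i) (hg : 0 < g) (hu : 0 < u) (hB : IsFactorAt (corr A) i B) {ω : Ω}
    (hω : ω ∈ maxEvent lam bet g B N u i) :
    threshold (lam i) (bet i) g u - Real.log d / (bet i * g) < N i ω := by
  have hd0 : (0 : ℝ) < d := by exact_mod_cast hd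
  have h1 : aggRisk lam bet g B N ω ≤ d * risk lam bet g B N i ω := by
    rw [aggRisk]
    refine (Finset.sum_le_card_nsmul _ _ (risk lam bet g B N i ω) fun j _ => ?_).trans ?_
    · rw [hω.2]; exact risk_le_maxRisk j ω
    · simp
  have h2 : u / d < lam i * Real.exp (bet i * g * N i ω) := by
    rw [div_lt_iff₀' hd0, ← hB.gaussVec_self (N := N) ω]
    exact hω.1.trans_le h1
  have h3 := (lt_mul_exp_iff (hlam i) (hbet i) hg (by positivity)).mp h2
  refine lt_of_eq_of_lt ?_ h3
  have hl := hlam i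
  rw [threshold, threshold, ← sub_div, ← Real.log_div (by positivity) (by positivity)]
  congr 2
  field_simp

/-- The event that every residual stays below `r` standard deviations. -/
def goodEvent (A B : Matrix (Fin d) (Fin d) ℝ) (N : Fin d → Ω → ℝ) (i : Fin d) (r : ℝ) : Set Ω :=
  {ω | ∀ j, j ≠ i → residual B N i j ω ≤ √(1 - corr A i j ^ 2) * r}

/-- At `N i = threshold`, with a margin `log d / (bet i * g)` for `N i` and with residuals of up
to `r` standard deviations, all the other risks are at most `w`. -/
def OthersBelow (lam bet : Fin d → ℝ) (g u : ℝ) (A : Matrix (Fin d) (Fin d) ℝ) (i : Fin d)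
    (r w : ℝ) : Prop :=
  ∀ j, j ≠ i → Real.log (lam j) + bet j * g * (corr A i j * threshold (lam i) (bet i) g u
    + Real.log d / (bet i * g) + √(1 - corr A i j ^ 2) * r) ≤ Real.log w

lemma measurableSet_goodEvent (r : ℝ) :
    MeasurableSet[sigmaExcept N i] (goodEvent A B N i r) := by
  have : goodEvent A B N i r
      = ⋂ j, ⋂ _ : j ≠ i, {ω | residual B N i j ω ≤ √(1 - corr A i j ^ 2) * r} := by
    ext ω
    simp [goodEvent]
  rw [this]
  refine MeasurableSet.iInter fun j => MeasurableSet.iInter fun _ => ?_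
  exact (measurable_residual B N i j) measurableSet_Iic

/-- On the good event the other risks together contribute at most `d ε e*` to the sum, so `X i`
has to be that close to `u`; in terms of `N i` the gap is of order `ε / threshold`. -/
lemma lt_of_mem_maxEvent_of_mem_goodEvent (hd : 1 ≤ d) (hlam : ∀ i, 0 < lam i)
    (hbet : ∀ i, 0 < bet i) (hg : 0 < g) (hu : 0 < u) (hA : ∀ i, corr A i i = 1)
    (hB : IsFactorAt (corr A) i B) (ha : 0 < threshold (lam i) (bet i) g u) {r ε : ℝ} (hε : 0 < ε)
    (hw : OthersBelow lam bet g u A i r (ε * (bet i * g * u / threshold (lam i) (bet i) g u)))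
    {ω : Ω} (hω : ω ∈ maxEvent lam bet g B N u i) (hG : ω ∈ goodEvent A B N i r) :
    threshold (lam i) (bet i) g u
      - d * (1 + Real.log d) * ε / threshold (lam i) (bet i) g u < N i ω := by
  have hd0 : (1 : ℝ) ≤ d := by exact_mod_cast hd
  have hlogd : 0 ≤ Real.log d := Real.log_nonneg hd0
  have hbi := hbet i
  have h1 := threshold_sub_lt_of_mem_maxEvent hd hlam hbet hg hu hB hω
  have hu' := mul_exp_threshold (hlam i) (hbet i) hg hu
  set a := threshold (lam i) (bet i) g u
  set w := ε * (bet i * g * u / a)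
  have hwpos : 0 < w := by positivity
  rcases lt_or_ge a (N i ω) with ht | ht
  · have : 0 ≤ d * (1 + Real.log d) * ε / a := by positivity
    linarith
  have hothers : ∀ j, j ≠ i → risk lam bet g B N j ω ≤ w := by
    intro j hj
    have h2 := hw j hj
    have h3 : bet j * g * gaussVec B N j ω ≤ bet j * g * (corr A i j * a
        + Real.log d / (bet i * g) + √(1 - corr A i j ^ 2) * r) := by
      refine mul_le_mul_of_nonneg_left ?_ (mul_pos (hbet j) hg).le
      rw [hB.gaussVec_eq]
      have h4 := hG j hj
      have h5 := abs_le_one_iff_mul_self_le_one.mpr (by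
        have := corr_sq_le_one hA i j
        rwa [sq] at this)
      have h6 : corr A i j * N i ω - corr A i j * a ≤ a - N i ω := by
        nlinarith [(abs_le.mp h5).1]
      linarith
    rw [risk, ← Real.log_le_log_iff (by have := hlam j; positivity) hwpos,
      Real.log_mul (hlam j).ne' (Real.exp_ne_zero _), Real.log_exp]
    linarith
  have hsum : aggRisk lam bet g B N ω ≤ risk lam bet g B N i ω + d * w := by
    rw [aggRisk, ← Finset.add_sum_erase _ _ (Finset.mem_univ i)]
    gcongr
    refine (Finset.sum_le_card_nsmul _ _ w fun j hj => hothers j (Finset.ne_of_mem_erase hj)).trans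
      ?_
    rw [nsmul_eq_mul]
    gcongr
    exact (Finset.card_erase_le).trans (by simp)
  have h7 : u < risk lam bet g B N i ω + d * w := hω.1.trans_le hsum
  -- with `X i = u exp (-x)`, the inequality `exp (-x) ≤ 1 / (1 + x)` bounds `x`
  set x := bet i * g * (a - N i ω)
  have hx0 : 0 ≤ x := by
    have : 0 ≤ a - N i ω := by linarith
    positivity
  have hx1 : x ≤ Real.log d := by
    have h8 : a - N i ω ≤ Real.log d / (bet i * g) := by linarith
    calc x ≤ bet i * g * (Real.log d / (bet i * g)) :=
          mul_le_mul_of_nonneg_left h8 (by positivity)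
      _ = Real.log d := by field_simp
  have h9 : risk lam bet g B N i ω = u * Real.exp (-x) := by
    rw [risk, hB.gaussVec_self, ← hu', mul_assoc (lam i), ← Real.exp_add]
    congr 2
    ring
  have h10 : Real.exp (-x) * (1 + x) ≤ 1 := by
    have h11 := Real.add_one_le_exp x
    calc Real.exp (-x) * (1 + x) ≤ Real.exp (-x) * Real.exp x := by gcongr; linarith
      _ = 1 := by rw [← Real.exp_add]; simp
  have h12 : u * x < d * (1 + Real.log d) * w := by
    have h13 : u * (1 + x) < (u * Real.exp (-x) + d * w) * (1 + x) := by
      rw [← h9]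
      exact mul_lt_mul_of_pos_right h7 (by linarith)
    have h14 : u * (Real.exp (-x) * (1 + x)) ≤ u * 1 := by gcongr
    have h15 : d * w * (1 + x) ≤ d * w * (1 + Real.log d) := by gcongr
    nlinarith
  have h16 : u * (bet i * g) * (a - N i ω)
      < u * (bet i * g) * (d * (1 + Real.log d) * ε / a) := by
    calc u * (bet i * g) * (a - N i ω) = u * x := by ring
      _ < d * (1 + Real.log d) * w := h12
      _ = _ := by simp only [w]; ring
  have h17 := lt_of_mul_lt_mul_left h16 (by positivity)
  linarith

/-- On the good event `X i > u` makes `X i` the largest risk: this holds at the threshold since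
`w ≤ u`, and `X i` grows at least as fast as `X j` with `N i` since `corr A i j * bet j ≤ bet i`. -/
lemma mem_maxEvent_of_mem_goodEvent (hlam : ∀ i, 0 < lam i)
    (hbet : ∀ i, 0 < bet i) (hg : 0 < g) (hu : 0 < u) (hA : ∀ i, corr A i i = 1)
    (hB : IsFactorAt (corr A) i B) (hmax : ∀ j, bet j ≤ bet i) {r w : ℝ} (hwpos : 0 < w)
    (hwu : w ≤ u) (hw : OthersBelow lam bet g u A i r w)
    {ω : Ω} (hω : threshold (lam i) (bet i) g u < N i ω) (hG : ω ∈ goodEvent A B N i r) :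
    ω ∈ maxEvent lam bet g B N u i := by
  have hd : (1 : ℝ) ≤ d := by exact_mod_cast (Nat.one_le_iff_ne_zero.mpr fun h => by
    subst h; exact i.elim0)
  have hXi : u < risk lam bet g B N i ω := by
    rw [risk, hB.gaussVec_self]
    exact (lt_mul_exp_iff (hlam i) (hbet i) hg hu).mpr hω
  have hle : ∀ j, risk lam bet g B N j ω ≤ risk lam bet g B N i ω := by
    intro j
    rcases eq_or_ne j i with rfl | hj
    · exact le_rfl
    have hu' := congrArg Real.log (mul_exp_threshold (hlam i) (hbet i) hg hu)
    rw [Real.log_mul (hlam i).ne' (Real.exp_ne_zero _), Real.log_exp] at hu'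
    have h2 := (hw j hj).trans (Real.log_le_log hwpos hwu)
    set a := threshold (lam i) (bet i) g u
    have hD : 0 ≤ Real.log d / (bet i * g) :=
      div_nonneg (Real.log_nonneg hd) (mul_pos (hbet i) hg).le
    have h5 := abs_le_one_iff_mul_self_le_one.mpr (by
      have := corr_sq_le_one hA i j
      rwa [sq] at this)
    have h3 : bet j * g * gaussVec B N j ω ≤ bet j * g * (corr A i j * a
        + Real.log d / (bet i * g) + √(1 - corr A i j ^ 2) * r) + bet i * g * (N i ω - a) := by
      have h4 : gaussVec B N j ω ≤ (corr A i j * a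
        + Real.log d / (bet i * g) + √(1 - corr A i j ^ 2) * r) + (N i ω - a) := by
        rw [hB.gaussVec_eq]
        have h4 := hG j hj
        have h6 : corr A i j * N i ω - corr A i j * a ≤ N i ω - a := by
          nlinarith [(abs_le.mp h5).2]
        linarith
      have h6 : bet j * g * (N i ω - a) ≤ bet i * g * (N i ω - a) := by
        have := hmax j
        have : 0 ≤ N i ω - a := by linarith
        gcongr
      have h7 := mul_le_mul_of_nonneg_left h4 (mul_pos (hbet j) hg).le
      rw [mul_add] at h7
      linarith
    rw [risk, risk, hB.gaussVec_self, ← Real.log_le_log_iff (by have := hlam j; positivity)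
      (by have := hlam i; positivity), Real.log_mul (hlam j).ne' (Real.exp_ne_zero _),
      Real.log_mul (hlam i).ne' (Real.exp_ne_zero _), Real.log_exp, Real.log_exp]
    linarith
  have : Nonempty (Fin d) := ⟨i⟩
  refine ⟨?_, le_antisymm (risk_le_maxRisk i ω) (ciSup_le hle)⟩
  refine hXi.trans_le (Finset.single_le_sum (f := fun j => risk lam bet g B N j ω)
    (fun j _ => ?_) (Finset.mem_univ i))
  exact mul_nonneg (hlam j).le (Real.exp_pos _).le

end Pathwise

/-! ### Moments of the conditional estimator -/

section Moments

variable {d : ℕ} {Ω : Type*} [MeasurableSpace Ω] {μ : Measure Ω} [IsProbabilityMeasure μ]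
  {N : Fin d → Ω → ℝ} {lam bet : Fin d → ℝ} {g u : ℝ} {A B : Matrix (Fin d) (Fin d) ℝ} {i : Fin d}

lemma measureReal_goodEvent_compl_le (hNm : ∀ i, Measurable (N i))
    (hN : ∀ i, μ.map (N i) = gaussianReal 0 1) (hNind : iIndepFun N μ)
    (hA : ∀ i, corr A i i = 1) (hB : IsFactorAt (corr A) i B) (r : ℝ) :
    μ.real (goodEvent A B N i r)ᶜ ≤ d * gaussTail r := by
  have hsub : (goodEvent A B N i r)ᶜ
      ⊆ ⋃ j, {ω | √(1 - corr A i j ^ 2) * r < residual B N i j ω} := by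
    intro ω hω
    simp only [goodEvent, Set.mem_compl_iff, Set.mem_ofPred_eq, not_forall, not_le] at hω
    obtain ⟨j, _, hj⟩ := hω
    exact Set.mem_iUnion.mpr ⟨j, hj⟩
  refine (measureReal_mono hsub).trans ((measureReal_iUnion_fintype_le _).trans ?_)
  refine (Finset.sum_le_card_nsmul _ _ (gaussTail r) fun j _ => ?_).trans (by simp)
  refine measureReal_linearCombination_gt_le hNm hN hNind _ (Real.sqrt_nonneg _) ?_
  rw [hB.sum_residual_sq (hA j), Real.sq_sqrt (by linarith [corr_sq_le_one hA i j])]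

/-- Split the second moment of the estimator along an event `G` of `σ(N_{-i})`. -/
lemma integral_condEst_sq_le (hNm : ∀ i, Measurable (N i))
    (hN : ∀ i, μ.map (N i) = gaussianReal 0 1) (hNind : iIndepFun N μ) {G : Set Ω}
    (hG : MeasurableSet[sigmaExcept N i] G) {w w' : ℝ}
    (hw : ∀ ω ∈ maxEvent lam bet g B N u i, w < N i ω)
    (hw' : ∀ ω ∈ maxEvent lam bet g B N u i, ω ∈ G → w' < N i ω) :
    ∫ ω, condEst μ lam bet g B N u i ω ^ 2 ∂μ
      ≤ gaussTail w' ^ 2 + gaussTail w ^ 2 * μ.real Gᶜ := by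
  have hm := sigmaExcept_le hNm i
  have hGc : MeasurableSet Gᶜ := (hm _ hG).compl
  have hint : Integrable (Gᶜ.indicator fun _ => gaussTail w ^ 2) μ :=
    (integrable_const _).indicator hGc
  have h : ∫ ω, condEst μ lam bet g B N u i ω ^ 2 ∂μ
      ≤ ∫ ω, (gaussTail w' ^ 2 + Gᶜ.indicator (fun _ => gaussTail w ^ 2) ω) ∂μ := by
    refine integral_mono_of_nonneg (Eventually.of_forall fun _ => sq_nonneg _)
      ((integrable_const _).add hint) ?_
    filter_upwards [condEst_nonneg (μ := μ) (lam := lam) (bet := bet) (g := g) (B := B) (N := N)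
      (u := u) (i := i), condEst_le_gaussTail (G := Set.univ) hNm hN hNind .univ
      (fun ω hω _ => hw ω hω), condEst_le_gaussTail hNm hN hNind hG hw'] with ω h0 h1 h2
    by_cases hωG : ω ∈ G
    · rw [Set.indicator_of_notMem (by simpa using hωG), add_zero]
      exact pow_le_pow_left₀ h0 (h2 hωG) 2
    · rw [Set.indicator_of_mem (by simpa using hωG)]
      have := pow_le_pow_left₀ h0 (h1 (Set.mem_univ _)) 2
      have := sq_nonneg (gaussTail w')
      linarith
  refine h.trans (le_of_eq ?_)
  rw [integral_add (integrable_const _) hint, integral_const, integral_indicator hGc,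
    setIntegral_const]
  simp [mul_comm]

lemma le_integral_condEst (hNm : ∀ i, Measurable (N i))
    (hN : ∀ i, μ.map (N i) = gaussianReal 0 1) (hNind : iIndepFun N μ) {G : Set Ω}
    (hG : MeasurableSet[sigmaExcept N i] G) {w : ℝ}
    (hw : ∀ ω ∈ G, w < N i ω → ω ∈ maxEvent lam bet g B N u i) :
    gaussTail w * (1 - μ.real Gᶜ) ≤ ∫ ω, condEst μ lam bet g B N u i ω ∂μ := by
  have h1 : μ.real (N i ⁻¹' Set.Ioi w ∩ G) = gaussTail w * μ.real G := by
    have h := (Indep_iff _ _ μ).mp (indep_sigmaExcept hNm hNind i) (N i ⁻¹' Set.Ioi w) G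
      ⟨Set.Ioi w, measurableSet_Ioi, rfl⟩ hG
    rw [measureReal_def, h, ENNReal.toReal_mul, gaussTail, ← hN i,
      map_measureReal_apply (hNm i) measurableSet_Ioi]
    rfl
  rw [integral_condEst hNm, ← probReal_compl_eq_one_sub (sigmaExcept_le hNm i _ hG).compl,
    compl_compl, ← h1]
  exact measureReal_mono fun ω hω => hw ω hω.2 hω.1

lemma integral_condEst_sq_le_of_othersBelow (hd : 1 ≤ d) (hNm : ∀ i, Measurable (N i))
    (hN : ∀ i, μ.map (N i) = gaussianReal 0 1) (hNind : iIndepFun N μ)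
    (hlam : ∀ i, 0 < lam i) (hbet : ∀ i, 0 < bet i) (hg : 0 < g) (hu : 0 < u)
    (hA : ∀ i, corr A i i = 1) (hB : IsFactorAt (corr A) i B)
    (ha : 0 < threshold (lam i) (bet i) g u) {r ε : ℝ} (hε : 0 < ε)
    (hw : OthersBelow lam bet g u A i r (ε * (bet i * g * u / threshold (lam i) (bet i) g u))) :
    ∫ ω, condEst μ lam bet g B N u i ω ^ 2 ∂μ
      ≤ gaussTail (threshold (lam i) (bet i) g u
          - d * (1 + Real.log d) * ε / threshold (lam i) (bet i) g u) ^ 2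
        + gaussTail (threshold (lam i) (bet i) g u - Real.log d / (bet i * g)) ^ 2
          * (d * gaussTail r) := by
  refine (integral_condEst_sq_le hNm hN hNind (measurableSet_goodEvent (A := A) (B := B) r)
    (fun ω hω => threshold_sub_lt_of_mem_maxEvent hd hlam hbet hg hu hB hω)
    (fun ω hω hG => lt_of_mem_maxEvent_of_mem_goodEvent hd hlam hbet hg hu hA hB ha hε hw hω
      hG)).trans ?_
  gcongr
  exact measureReal_goodEvent_compl_le hNm hN hNind hA hB r

lemma le_integral_condEst_of_othersBelow (hNm : ∀ i, Measurable (N i))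
    (hN : ∀ i, μ.map (N i) = gaussianReal 0 1) (hNind : iIndepFun N μ)
    (hlam : ∀ i, 0 < lam i) (hbet : ∀ i, 0 < bet i) (hg : 0 < g) (hu : 0 < u)
    (hA : ∀ i, corr A i i = 1) (hB : IsFactorAt (corr A) i B) (hmax : ∀ j, bet j ≤ bet i)
    {r w : ℝ} (hwpos : 0 < w) (hwu : w ≤ u) (hw : OthersBelow lam bet g u A i r w) :
    gaussTail (threshold (lam i) (bet i) g u) * (1 - d * gaussTail r)
      ≤ ∫ ω, condEst μ lam bet g B N u i ω ∂μ := by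
  refine le_trans ?_ (le_integral_condEst hNm hN hNind (measurableSet_goodEvent (A := A) (B := B) r)
    (fun ω hG hω => mem_maxEvent_of_mem_goodEvent hlam hbet hg hu hA hB hmax hwpos hwu hw hω hG))
  refine mul_le_mul_of_nonneg_left ?_ (gaussTail_pos _).le
  linarith [measureReal_goodEvent_compl_le hNm hN hNind hA hB r]

end Moments

/-! ### Thresholds and tails for large `u` -/

section Asymptotics

variable {l b g₀ : ℝ} {g : ℝ → ℝ}

lemma tendsto_div_log_atTop {f : ℝ → ℝ} {c : ℝ} (hf : Tendsto f atTop (𝓝 c)) :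
    Tendsto (fun u => f u / Real.log u) atTop (𝓝 0) :=
  hf.div_atTop Real.tendsto_log_atTop

lemma tendsto_threshold_div_log (hl : 0 < l) (hb : 0 < b) (hg₀ : 0 < g₀)
    (hglim : Tendsto g atTop (𝓝 g₀)) :
    Tendsto (fun u => threshold l b (g u) u / Real.log u) atTop (𝓝 (1 / (b * g₀))) := by
  have h1 : Tendsto (fun u => (1 - Real.log l / Real.log u) / (b * g u)) atTop
      (𝓝 ((1 - 0) / (b * g₀))) :=
    (tendsto_const_nhds.sub (tendsto_div_log_atTop tendsto_const_nhds)).div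
      (hglim.const_mul b) (by positivity)
  rw [sub_zero] at h1
  refine h1.congr' ?_
  filter_upwards [eventually_gt_atTop 1] with u hu
  have := Real.log_pos hu
  rw [threshold, Real.log_div (by positivity) hl.ne']
  field_simp

lemma tendsto_threshold_atTop (hl : 0 < l) (hb : 0 < b) (hg₀ : 0 < g₀)
    (hglim : Tendsto g atTop (𝓝 g₀)) :
    Tendsto (fun u => threshold l b (g u) u) atTop atTop := by
  have h1 := (tendsto_threshold_div_log hl hb hg₀ hglim).pos_mul_atTop (by positivity)
    Real.tendsto_log_atTop
  refine h1.congr' ?_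
  filter_upwards [eventually_gt_atTop 1] with u hu
  exact div_mul_cancel₀ _ (Real.log_pos hu).ne'

/-- The scaling function in terms of the Gaussian threshold: `log v` is exactly `threshold`. -/
lemma scaleStar_eq {l b g u : ℝ} (hl : 0 < l) (hu : 0 < u) :
    scaleStar l b g u = b * g * u / threshold l b g u := by
  have hv : 0 < u / l := by positivity
  have h1 : (u / l) ^ (1 / (b * g)) * (u / l) ^ (-(1 / (b * g))) = 1 := by
    rw [← Real.rpow_add hv, add_neg_cancel, Real.rpow_zero]
  have h2 : Real.log ((u / l) ^ (1 / (b * g))) = threshold l b g u := by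
    rw [Real.log_rpow hv, threshold]
    ring
  rw [scaleStar, scaleFun, h2]
  calc _ = b * g * u / threshold l b g u
        * ((u / l) ^ (1 / (b * g)) * (u / l) ^ (-(1 / (b * g)))) := by ring
    _ = _ := by rw [h1, mul_one]

lemma tendsto_log_scale_div_log (hl : 0 < l) (hb : 0 < b) (hg₀ : 0 < g₀)
    (hglim : Tendsto g atTop (𝓝 g₀)) {ε : ℝ} (hε : 0 < ε) :
    Tendsto (fun u => Real.log (ε * (b * g u * u / threshold l b (g u) u)) / Real.log u)
      atTop (𝓝 1) := by
  have ha := tendsto_threshold_atTop hl hb hg₀ hglim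
  have h1 : Tendsto (fun u => Real.log (ε * (b * g u))) atTop (𝓝 (Real.log (ε * (b * g₀)))) :=
    ((hglim.const_mul b).const_mul ε).log (by positivity)
  have h2 : Tendsto (fun u => Real.log (threshold l b (g u) u) / threshold l b (g u) u) atTop
      (𝓝 0) := (Real.isLittleO_log_id_atTop.tendsto_div_nhds_zero).comp ha
  have h3 := h2.mul (tendsto_threshold_div_log hl hb hg₀ hglim)
  have h4 := ((tendsto_div_log_atTop h1).add (tendsto_const_nhds (x := (1 : ℝ)))).sub h3
  rw [zero_mul, zero_add, sub_zero] at h4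
  refine h4.congr' ?_
  filter_upwards [eventually_gt_atTop 1, ha.eventually_gt_atTop 0,
    hglim.eventually_const_lt hg₀] with u hu ha hg
  have hL := Real.log_pos hu
  have hu0 : 0 < u := by linarith
  have h5 : ε * (b * g u * u / threshold l b (g u) u)
      = ε * (b * g u) * u / threshold l b (g u) u := by ring
  rw [h5, Real.log_div (by positivity) ha.ne', Real.log_mul (by positivity) hu0.ne']
  field_simp

lemma eventually_mul_threshold_le (hl : 0 < l) (hb : 0 < b) (hg₀ : 0 < g₀)
    (hglim : Tendsto g atTop (𝓝 g₀)) (c : ℝ) :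
    ∀ᶠ u in atTop, c / (b * g u) * threshold l b (g u) u
      ≤ (c / (b * g₀) * (1 / (b * g₀)) + 1) * Real.log u := by
  have h1 : Tendsto (fun u => c / (b * g u) * (threshold l b (g u) u / Real.log u)) atTop
      (𝓝 (c / (b * g₀) * (1 / (b * g₀)))) :=
    ((tendsto_const_nhds (x := c)).div (hglim.const_mul b) (by positivity)).mul
      (tendsto_threshold_div_log hl hb hg₀ hglim)
  filter_upwards [h1.eventually_lt_const (lt_add_one _), eventually_gt_atTop 1] with u h hu
  have hL := Real.log_pos hu
  rw [← mul_div_assoc, div_lt_iff₀ hL] at h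
  exact h.le

lemma one_add_mul_exp_le {x : ℝ} (hx : 0 ≤ x) :
    1 + x * Real.exp (x + 2) ≤ Real.exp (2 * x + 3) := by
  have h1 : 1 ≤ Real.exp (2 * x + 2) := Real.one_le_exp (by linarith)
  have h2 : x * Real.exp (x + 2) ≤ Real.exp (2 * x + 2) := by
    calc x * Real.exp (x + 2) ≤ Real.exp x * Real.exp (x + 2) := by
          gcongr
          linarith [Real.add_one_le_exp x]
      _ = _ := by rw [← Real.exp_add]; congr 1; ring
  have h3 : Real.exp (2 * x + 3) = Real.exp 1 * Real.exp (2 * x + 2) := by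
    rw [← Real.exp_add]; congr 1; ring
  have h4 : 2 ≤ Real.exp 1 := by linarith [Real.add_one_le_exp (1 : ℝ)]
  nlinarith

/-- Lowering the threshold from `u` to `u / d` raises the marginal tail by at most a power
of `u`. -/
lemma exists_eventually_gaussTail_sub_sq_le (hl : 0 < l) (hb : 0 < b) (hg₀ : 0 < g₀)
    (hglim : Tendsto g atTop (𝓝 g₀)) {c : ℝ} (hc : 0 ≤ c) :
    ∃ C : ℝ, 0 < C ∧ ∀ᶠ u in atTop, gaussTail (threshold l b (g u) u - c / (b * g u)) ^ 2
      ≤ Real.exp (6 + C * Real.log u) * gaussTail (threshold l b (g u) u) ^ 2 := by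
  refine ⟨4 * (c / (b * g₀) * (1 / (b * g₀)) + 1), by positivity, ?_⟩
  have hD : Tendsto (fun u => c / (b * g u)) atTop (𝓝 (c / (b * g₀))) :=
    (tendsto_const_nhds (x := c)).div (hglim.const_mul b) (by positivity)
  filter_upwards [eventually_mul_threshold_le hl hb hg₀ hglim c,
    (tendsto_threshold_atTop hl hb hg₀ hglim).eventually_ge_atTop 1,
    (tendsto_threshold_atTop hl hb hg₀ hglim).eventually_ge_atTop (c / (b * g₀) + 1),
    hD.eventually_lt_const (lt_add_one _), hglim.eventually_const_lt hg₀] with u h1 h2 h3 h4 h5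
  set a := threshold l b (g u) u
  have hs : 0 ≤ c / (b * g u) := by positivity
  have h6 := gaussTail_sub_le h2 hs (by linarith)
  have h7 := one_add_mul_exp_le (mul_nonneg hs (show 0 ≤ a by linarith))
  have h8 : gaussTail (a - c / (b * g u)) ≤ Real.exp (2 * (c / (b * g u) * a) + 3) * gaussTail a :=
    h6.trans (mul_le_mul_of_nonneg_right h7 (gaussTail_pos _).le)
  calc gaussTail (a - c / (b * g u)) ^ 2
      ≤ (Real.exp (2 * (c / (b * g u) * a) + 3) * gaussTail a) ^ 2 :=
        pow_le_pow_left₀ (gaussTail_pos _).le h8 2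
    _ = Real.exp (6 + 4 * (c / (b * g u) * a)) * gaussTail a ^ 2 := by
        rw [mul_pow, ← Real.exp_nat_mul]
        congr 2
        push_cast
        ring
    _ ≤ _ := by
        gcongr ?_ * _
        rw [Real.exp_le_exp]
        linarith

/-- A strictly smaller `b` makes the marginal tail smaller by more than any power of `u`. -/
lemma eventually_gaussTail_threshold_le {l' b' : ℝ} (hl : 0 < l) (hb : 0 < b) (hl' : 0 < l')
    (hbb' : b < b') (hg₀ : 0 < g₀) (hglim : Tendsto g atTop (𝓝 g₀)) (C : ℝ) {δ : ℝ}
    (hδ : 0 < δ) :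
    ∀ᶠ u in atTop, Real.exp (6 + C * Real.log u) * gaussTail (threshold l b (g u) u)
      ≤ δ * gaussTail (threshold l' b' (g u) u) := by
  have hb' : 0 < b' := hb.trans hbb'
  have h1 := tendsto_threshold_div_log hl hb hg₀ hglim
  have h2 := tendsto_threshold_div_log hl' hb' hg₀ hglim
  have hgap : 0 < 1 / (b * g₀) - 1 / (b' * g₀) := by
    rw [sub_pos]
    exact one_div_lt_one_div_of_lt (by positivity) (by gcongr)
  have h3 := h2.mul (h1.sub h2)
  have h4 : Tendsto (fun u => threshold l' b' (g u) u / Real.log u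
      * (threshold l b (g u) u / Real.log u - threshold l' b' (g u) u / Real.log u) * Real.log u
      - C) atTop atTop :=
    tendsto_atTop_add_const_right _ _ (h3.pos_mul_atTop (by positivity) Real.tendsto_log_atTop)
  have h5 := h4.atTop_mul_atTop₀ Real.tendsto_log_atTop
  filter_upwards [h5.eventually_ge_atTop (6 - Real.log δ), (h1.sub h2).eventually_const_lt hgap,
    eventually_gt_atTop 1] with u h6 h7 hu
  have hL := Real.log_pos hu
  set a := threshold l b (g u) u
  set a' := threshold l' b' (g u) u
  have h8 : 0 ≤ a - a' := by
    rw [← sub_div] at h7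
    exact (div_pos_iff_of_pos_right hL).mp h7 |>.le
  have h9 := gaussTail_add_le a' h8
  rw [add_sub_cancel] at h9
  have h10 : a' / Real.log u * (a / Real.log u - a' / Real.log u) * Real.log u * Real.log u
      = a' * (a - a') := by field_simp
  calc Real.exp (6 + C * Real.log u) * gaussTail a
      ≤ Real.exp (6 + C * Real.log u) * (Real.exp (-(a' * (a - a')) - (a - a') ^ 2 / 2)
        * gaussTail a') := by gcongr
    _ = Real.exp (6 + C * Real.log u + (-(a' * (a - a')) - (a - a') ^ 2 / 2)) * gaussTail a' := by
        rw [Real.exp_add (6 + C * Real.log u), mul_assoc]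
    _ ≤ Real.exp (Real.log δ) * gaussTail a' := by
        have := gaussTail_pos a'
        gcongr
        nlinarith [sq_nonneg (a - a')]
    _ = _ := by rw [Real.exp_log hδ]

end Asymptotics

/-! ### Indices of maximal `bet` and the condition on the correlations -/

section MaxIdx

variable {d : ℕ} {bet : Fin d → ℝ}

lemma le_of_mem_maxIdx {i : Fin d} (hi : i ∈ maxIdx bet) (j : Fin d) : bet j ≤ bet i := by
  rw [show bet i = ⨆ k, bet k from hi]
  exact le_ciSup (Set.finite_range bet).bddAbove j

lemma lt_of_notMem_maxIdx {i j : Fin d} (hi : i ∈ maxIdx bet) (hj : j ∉ maxIdx bet) :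
    bet j < bet i :=
  lt_of_le_of_ne (le_of_mem_maxIdx hi j) fun h => hj (h.trans hi)

lemma exists_mem_maxIdx (hd : 1 ≤ d) : ∃ i, i ∈ maxIdx bet := by
  have : Nonempty (Fin d) := ⟨⟨0, hd⟩⟩
  exact exists_eq_ciSup_of_finite

end MaxIdx

/-- The condition on the correlations, with residuals of up to `√(2 K log u)` standard
deviations. An index `j` outside `maxIdx` needs no condition, since there `X j` stays below a
power of `u` smaller than one. -/
lemma eventually_othersBelow {d : ℕ} {lam bet : Fin d → ℝ} (hlam : ∀ i, 0 < lam i)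
    (hbet : ∀ i, 0 < bet i) {g : ℝ → ℝ} {g₀ : ℝ} (hg₀ : 0 < g₀) (hglim : Tendsto g atTop (𝓝 g₀))
    {A : ℝ → Matrix (Fin d) (Fin d) ℝ} (hA : ∀ u, 0 < u → ∀ i, corr (A u) i i = 1)
    (hcond : ∀ c : ℝ, 0 < c → ∀ ε : ℝ, 0 < ε → ∃ u₀ : ℝ, 0 < u₀ ∧ ∀ u, u₀ < u →
      ∀ i ∈ maxIdx bet, ∀ j ∈ maxIdx bet, i ≠ j →
        corr (A u) i j + c * √((1 - corr (A u) i j ^ 2) / Real.log u) ≤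
          bet j / bet i * (Real.log (ε * scaleStar (lam i) (bet i) (g u) u) / Real.log u))
    {i : Fin d} (hi : i ∈ maxIdx bet) {ε K : ℝ} (hε : 0 < ε) (hK : 0 < K) :
    ∀ᶠ u in atTop, OthersBelow lam bet (g u) u (A u) i √(2 * K * Real.log u)
      (ε * (bet i * g u * u / threshold (lam i) (bet i) (g u) u)) := by
  have hd : 1 ≤ d := Nat.one_le_iff_ne_zero.mpr fun h => by subst h; exact i.elim0
  have hlogd : 0 ≤ Real.log d := Real.log_nonneg (by exact_mod_cast hd)
  refine eventually_all.mpr fun j => ?_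
  rcases eq_or_ne j i with rfl | hji
  · exact Eventually.of_forall fun u h => absurd rfl h
  have hbi := hbet i
  have hbj := hbet j
  have hli := hlam i
  have ha := tendsto_threshold_atTop hli hbi hg₀ hglim
  by_cases hj : j ∈ maxIdx bet
  · have hbb : bet j = bet i := le_antisymm (le_of_mem_maxIdx hi j) (le_of_mem_maxIdx hj i)
    -- all bounded terms are absorbed into the constant that multiplies the scale
    let C := Real.log (lam j) + |Real.log (lam i)| + Real.log d
    have hε' : 0 < ε * Real.exp (-C) := by positivity
    obtain ⟨u₀, -, h⟩ := hcond (bet i * (2 * g₀) * √(2 * K)) (by positivity) _ hε'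
    filter_upwards [eventually_gt_atTop u₀, eventually_gt_atTop 1, ha.eventually_gt_atTop 0,
      hglim.eventually_const_lt hg₀, hglim.eventually_lt_const (show g₀ < 2 * g₀ by linarith)]
      with u h1 hu ha hg hg2 _
    have hL := Real.log_pos hu
    have hu0 : 0 < u := by linarith
    have h2 := h u h1 i hi j hj hji.symm
    rw [hbb, div_self hbi.ne', one_mul, scaleStar_eq hli hu0, le_div_iff₀ hL] at h2
    have hσ := corr_sq_le_one (hA u hu0) i j
    set σ := corr (A u) i j
    have hth : bet i * g u * threshold (lam i) (bet i) (g u) u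
        = Real.log u - Real.log (lam i) := by
      rw [threshold, mul_div_cancel₀ _ (by positivity), Real.log_div hu0.ne' hli.ne']
    set a := threshold (lam i) (bet i) (g u) u
    have h3 : Real.log (ε * Real.exp (-C) * (bet i * g u * u / a))
        = Real.log (ε * (bet i * g u * u / a)) - C := by
      rw [mul_right_comm, Real.log_mul (by positivity) (Real.exp_ne_zero _), Real.log_exp]
      ring
    rw [h3, add_mul] at h2
    have h4 : √((1 - σ ^ 2) / Real.log u) * Real.log u = √(1 - σ ^ 2) * √(Real.log u) := by
      rw [Real.sqrt_div (by linarith), div_mul_eq_mul_div, div_eq_iff (by positivity), mul_assoc,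
        Real.mul_self_sqrt hL.le]
    have h5 : bet i * g u * (√(1 - σ ^ 2) * √(2 * K * Real.log u))
        ≤ bet i * (2 * g₀) * √(2 * K) * √((1 - σ ^ 2) / Real.log u) * Real.log u := by
      rw [mul_assoc _ (√((1 - σ ^ 2) / Real.log u)), h4, Real.sqrt_mul (by positivity)]
      calc _ ≤ bet i * (2 * g₀) * (√(1 - σ ^ 2) * (√(2 * K) * √(Real.log u))) := by gcongr
        _ = _ := by ring
    have h6 : -(σ * Real.log (lam i)) ≤ |Real.log (lam i)| := by
      have h7 : |σ| ≤ 1 := abs_le_one_iff_mul_self_le_one.mpr (by rwa [sq] at hσ)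
      calc -(σ * Real.log (lam i)) ≤ |σ * Real.log (lam i)| := neg_le_abs _
        _ = |σ| * |Real.log (lam i)| := abs_mul _ _
        _ ≤ 1 * |Real.log (lam i)| := by gcongr
        _ = _ := one_mul _
    have h8 : bet i * g u * (σ * a + Real.log d / (bet i * g u)
        + √(1 - σ ^ 2) * √(2 * K * Real.log u))
        = σ * (bet i * g u * a) + Real.log d
          + bet i * g u * (√(1 - σ ^ 2) * √(2 * K * Real.log u)) := by
      field_simp
    rw [hbb, h8, hth]
    simp only [C] at h2
    linarith
  · have hbb := lt_of_notMem_maxIdx hi hj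
    -- divided by `log u`, the left side is at most about `bet j / bet i < 1`, the right side
    -- about `1`
    have hr : Tendsto (fun u => √(2 * K) * (√(Real.log u) / Real.log u)) atTop (𝓝 0) := by
      have h1 : Tendsto (fun u => √(2 * K) * (√(Real.log u))⁻¹) atTop (𝓝 (√(2 * K) * 0)) :=
        ((tendsto_inv_atTop_zero.comp
          (Real.tendsto_sqrt_atTop.comp Real.tendsto_log_atTop)).const_mul _)
      rw [mul_zero] at h1
      refine h1.congr' ?_
      filter_upwards [eventually_gt_atTop 1] with u hu
      have hL := Real.log_pos hu
      rw [Real.sqrt_div_self]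
    have hlhs : Tendsto (fun u => Real.log (lam j) / Real.log u + bet j * g u
        * (threshold (lam i) (bet i) (g u) u / Real.log u
          + Real.log d / (bet i * g u) / Real.log u + √(2 * K) * (√(Real.log u) / Real.log u)))
        atTop (𝓝 (0 + bet j * g₀ * (1 / (bet i * g₀) + 0 + 0))) :=
      (tendsto_div_log_atTop tendsto_const_nhds).add ((hglim.const_mul _).mul
        (((tendsto_threshold_div_log hli hbi hg₀ hglim).add (tendsto_div_log_atTop
          ((tendsto_const_nhds (x := Real.log d)).div (hglim.const_mul _) (by positivity)))).add hr))
    have hlt : 0 + bet j * g₀ * (1 / (bet i * g₀) + 0 + 0) < 1 := by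
      have : 0 + bet j * g₀ * (1 / (bet i * g₀) + 0 + 0) = bet j / bet i := by
        field_simp
        ring
      rw [this, div_lt_one hbi]
      exact hbb
    filter_upwards [hlhs.eventually_lt (tendsto_log_scale_div_log hli hbi hg₀ hglim hε) hlt,
      eventually_gt_atTop 1, ha.eventually_gt_atTop 0, hglim.eventually_const_lt hg₀]
      with u h1 hu ha hg _
    have hL := Real.log_pos hu
    have hu0 : 0 < u := by linarith
    have hσ := corr_sq_le_one (hA u hu0) i j
    rw [lt_div_iff₀ hL] at h1
    set σ := corr (A u) i j
    set a := threshold (lam i) (bet i) (g u) u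
    have h7 : σ ≤ 1 := (abs_le.mp (abs_le_one_iff_mul_self_le_one.mpr (by rwa [sq] at hσ))).2
    have h8 : √(1 - σ ^ 2) ≤ 1 := Real.sqrt_le_one.mpr (by linarith [sq_nonneg σ])
    refine le_trans ?_ h1.le
    have h9 : (Real.log (lam j) / Real.log u + bet j * g u
        * (a / Real.log u + Real.log d / (bet i * g u) / Real.log u
          + √(2 * K) * (√(Real.log u) / Real.log u))) * Real.log u
        = Real.log (lam j) + bet j * g u * (1 * a + Real.log d / (bet i * g u)
          + 1 * (√(2 * K) * √(Real.log u))) := by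
      field_simp
    rw [h9, Real.sqrt_mul (by positivity)]
    gcongr

/-! ### Asymptotics of the moments -/

/-- For an index of maximal `bet`, the estimator `Z i` has asymptotically the mean and the second
moment of the constant `P(X i > u)`. -/
lemma eventually_moments_of_mem_maxIdx {d : ℕ} {Ω : Type*} [MeasurableSpace Ω] {μ : Measure Ω}
    [IsProbabilityMeasure μ] {N : Fin d → Ω → ℝ} (hNm : ∀ i, Measurable (N i))
    (hN : ∀ i, μ.map (N i) = gaussianReal 0 1) (hNind : iIndepFun N μ)
    {lam bet : Fin d → ℝ} (hlam : ∀ i, 0 < lam i)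
    (hbet : ∀ i, 0 < bet i) {g : ℝ → ℝ} {g₀ : ℝ} (hg₀ : 0 < g₀) (hglim : Tendsto g atTop (𝓝 g₀))
    {A : ℝ → Matrix (Fin d) (Fin d) ℝ} (hA : ∀ u, 0 < u → ∀ i, corr (A u) i i = 1)
    {B : ℝ → Fin d → Matrix (Fin d) (Fin d) ℝ}
    (hB : ∀ u, 0 < u → ∀ j, IsFactorAt (corr (A u)) j (B u j))
    {i : Fin d} (hi : i ∈ maxIdx bet)
    (hbelow : ∀ ε K : ℝ, 0 < ε → 0 < K →
      ∀ᶠ u in atTop, OthersBelow lam bet (g u) u (A u) i √(2 * K * Real.log u)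
        (ε * (bet i * g u * u / threshold (lam i) (bet i) (g u) u)))
    {δ : ℝ} (hδ : 0 < δ) :
    ∀ᶠ u in atTop,
      ∫ ω, condEst μ lam bet (g u) (B u i) N u i ω ^ 2 ∂μ
        ≤ (1 + δ) * gaussTail (threshold (lam i) (bet i) (g u) u) ^ 2 ∧
      (1 - δ) * gaussTail (threshold (lam i) (bet i) (g u) u)
        ≤ ∫ ω, condEst μ lam bet (g u) (B u i) N u i ω ∂μ := by
  have hd : 1 ≤ d := Nat.one_le_iff_ne_zero.mpr fun h => by subst h; exact i.elim0
  have hd0 : (1 : ℝ) ≤ d := by exact_mod_cast hd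
  have hlogd : 0 ≤ Real.log d := Real.log_nonneg hd0
  have hbi := hbet i
  have hli := hlam i
  have ha := tendsto_threshold_atTop hli hbi hg₀ hglim
  obtain ⟨h, hh0, hh⟩ : ∃ h : ℝ, 0 < h ∧ (1 + h * Real.exp (h + 2)) ^ 2 < 1 + δ / 2 := by
    have hcont : Continuous fun h : ℝ => (1 + h * Real.exp (h + 2)) ^ 2 := by fun_prop
    have h1 : ∀ᶠ h in 𝓝[>] (0 : ℝ), (1 + h * Real.exp (h + 2)) ^ 2 < 1 + δ / 2 :=
      (hcont.tendsto 0).mono_left nhdsWithin_le_nhds |>.eventually_lt_const (by simp; linarith)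
    obtain ⟨h, h2, h3⟩ := (h1.and self_mem_nhdsWithin).exists
    exact ⟨h, h3, h2⟩
  -- this `ε` makes the gap of `lt_of_mem_maxEvent_of_mem_goodEvent` equal to `h / threshold`
  have hε : 0 < h / (d * (1 + Real.log d)) := by positivity
  obtain ⟨C, hC, hCu⟩ := exists_eventually_gaussTail_sub_sq_le hli hbi hg₀ hglim hlogd
  -- `K = C + 1` makes the exceptional event smaller than the power of `u` lost in `hCu`
  have hsmall : Tendsto (fun u => d * Real.exp (6 - Real.log u)) atTop (𝓝 (d * 0)) :=
    (Real.tendsto_exp_atBot.comp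
      (tendsto_atBot_add_const_left _ 6 (tendsto_neg_atTop_atBot.comp
        Real.tendsto_log_atTop))).const_mul _
  rw [mul_zero] at hsmall
  filter_upwards [hCu, hbelow _ (C + 1) hε (by linarith), hsmall.eventually_lt_const
    (show 0 < δ / 2 by linarith), eventually_gt_atTop 1, ha.eventually_ge_atTop 1,
    ha.eventually_ge_atTop h,
    ha.eventually_ge_atTop (h / (d * (1 + Real.log d)) * (bet i * (2 * g₀))),
    hglim.eventually_const_lt hg₀, hglim.eventually_lt_const (show g₀ < 2 * g₀ by linarith)]
    with u h1 h2 h3 hu ha1 hah haw hg hg2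
  have hL := Real.log_pos hu
  have hu0 : 0 < u := by linarith
  have hr : gaussTail √(2 * (C + 1) * Real.log u) ≤ Real.exp (-((C + 1) * Real.log u)) := by
    refine (gaussTail_le_exp (Real.sqrt_nonneg _)).trans (le_of_eq ?_)
    rw [Real.sq_sqrt (by positivity)]
    congr 1
    ring
  set r := √(2 * (C + 1) * Real.log u)
  set ε := h / (d * (1 + Real.log d)) with hεdef
  have hεh : d * (1 + Real.log d) * ε = h := by
    rw [hεdef]
    field_simp
  have hsq := integral_condEst_sq_le_of_othersBelow hd hNm hN hNind hlam hbet hg hu0 (hA u hu0)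
    (hB u hu0 i) (by linarith) hε h2
  have hwu : ε * (bet i * g u * u / threshold (lam i) (bet i) (g u) u) ≤ u := by
    rw [← mul_div_assoc, div_le_iff₀ (by linarith)]
    calc ε * (bet i * g u * u) = u * (ε * (bet i * g u)) := by ring
      _ ≤ u * (ε * (bet i * (2 * g₀))) := by gcongr
      _ ≤ _ := by gcongr
  have hwpos : 0 < ε * (bet i * g u * u / threshold (lam i) (bet i) (g u) u) := by
    have : 0 < threshold (lam i) (bet i) (g u) u := by linarith
    positivity
  have hlow := le_integral_condEst_of_othersBelow hNm hN hNind hlam hbet hg hu0 (hA u hu0)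
    (hB u hu0 i) (le_of_mem_maxIdx hi) hwpos hwu h2
  rw [hεh] at hsq
  set a := threshold (lam i) (bet i) (g u) u
  have ha0 : 0 < a := by linarith
  have hp := gaussTail_pos a
  have hexp : Real.exp (6 + C * Real.log u) * Real.exp (-((C + 1) * Real.log u))
      = Real.exp (6 - Real.log u) := by
    rw [← Real.exp_add]
    congr 1
    ring
  constructor
  · have hnear : gaussTail (a - h / a) ≤ (1 + h * Real.exp (h + 2)) * gaussTail a := by
      have h4 := gaussTail_sub_le (s := h / a) ha1 (by positivity)
        (by rw [div_le_iff₀ ha0]; nlinarith)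
      rwa [div_mul_cancel₀ _ ha0.ne'] at h4
    have h5 : gaussTail (a - h / a) ^ 2 ≤ (1 + δ / 2) * gaussTail a ^ 2 := by
      refine (pow_le_pow_left₀ (gaussTail_pos _).le hnear 2).trans ?_
      rw [mul_pow]
      gcongr
    have h6 : gaussTail (a - Real.log d / (bet i * g u)) ^ 2 * (d * gaussTail r)
        ≤ δ / 2 * gaussTail a ^ 2 := by
      calc _ ≤ Real.exp (6 + C * Real.log u) * gaussTail a ^ 2
            * (d * Real.exp (-((C + 1) * Real.log u))) := by
            have := gaussTail_pos r
            gcongr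
        _ = d * Real.exp (6 - Real.log u) * gaussTail a ^ 2 := by rw [← hexp]; ring
        _ ≤ _ := by gcongr
    linarith
  · refine le_trans ?_ hlow
    have h7 : d * gaussTail r ≤ δ := by
      have h8 : Real.exp (-((C + 1) * Real.log u)) ≤ Real.exp (6 - Real.log u) := by
        rw [Real.exp_le_exp]
        nlinarith
      calc d * gaussTail r ≤ d * Real.exp (6 - Real.log u) := by
            gcongr
            exact hr.trans h8
        _ ≤ δ := by linarith
    rw [mul_comm]
    gcongr

/-- An index outside `maxIdx` is negligible: its marginal tail is, and the crude bound
`Z i ≤ P(X i > u / d)` loses only a power of `u`. -/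
lemma eventually_moments_of_notMem_maxIdx {d : ℕ} {Ω : Type*} [MeasurableSpace Ω] {μ : Measure Ω}
    [IsProbabilityMeasure μ] {N : Fin d → Ω → ℝ} (hNm : ∀ i, Measurable (N i))
    (hN : ∀ i, μ.map (N i) = gaussianReal 0 1) (hNind : iIndepFun N μ)
    {lam bet : Fin d → ℝ} (hlam : ∀ i, 0 < lam i)
    (hbet : ∀ i, 0 < bet i) {g : ℝ → ℝ} {g₀ : ℝ} (hg₀ : 0 < g₀) (hglim : Tendsto g atTop (𝓝 g₀))
    {A : ℝ → Matrix (Fin d) (Fin d) ℝ}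
    {B : ℝ → Fin d → Matrix (Fin d) (Fin d) ℝ}
    (hB : ∀ u, 0 < u → ∀ j, IsFactorAt (corr (A u)) j (B u j))
    {i j : Fin d} (hj : j ∈ maxIdx bet) (hi : i ∉ maxIdx bet) {δ : ℝ} (hδ : 0 < δ) :
    ∀ᶠ u in atTop,
      ∫ ω, condEst μ lam bet (g u) (B u i) N u i ω ^ 2 ∂μ
        ≤ δ * gaussTail (threshold (lam j) (bet j) (g u) u)
          * gaussTail (threshold (lam i) (bet i) (g u) u) ∧
      gaussTail (threshold (lam i) (bet i) (g u) u)
        ≤ δ * gaussTail (threshold (lam j) (bet j) (g u) u) := by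
  have hd : 1 ≤ d := Nat.one_le_iff_ne_zero.mpr fun h => by subst h; exact i.elim0
  have hlogd : 0 ≤ Real.log d := Real.log_nonneg (by exact_mod_cast hd)
  obtain ⟨C, hC, hCu⟩ := exists_eventually_gaussTail_sub_sq_le (hlam i) (hbet i) hg₀ hglim hlogd
  filter_upwards [hCu, eventually_gaussTail_threshold_le (hlam i) (hbet i) (hlam j)
    (lt_of_notMem_maxIdx hj hi) hg₀ hglim C hδ, eventually_gt_atTop 1,
    hglim.eventually_const_lt hg₀] with u h1 h2 hu hg
  have hL := Real.log_pos hu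
  have hu0 : 0 < u := by linarith
  have hp := gaussTail_pos (threshold (lam i) (bet i) (g u) u)
  constructor
  · have h3 := integral_condEst_sq_le (G := Set.univ) hNm hN hNind .univ
      (fun ω hω => threshold_sub_lt_of_mem_maxEvent hd hlam hbet hg hu0 (hB u hu0 i) hω)
      (fun ω hω _ => threshold_sub_lt_of_mem_maxEvent hd hlam hbet hg hu0 (hB u hu0 i) hω)
    rw [Set.compl_univ, measureReal_empty, mul_zero, add_zero] at h3
    refine h3.trans (h1.trans ?_)
    rw [sq, ← mul_assoc]
    gcongr
  · refine le_trans ?_ h2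
    exact le_mul_of_one_le_left hp.le (Real.one_le_exp (by positivity))

/-- Comparison of the second moment `(∑ p) * ∑ m₂ / p` of a stratified estimator with the square
of its mean `∑ m₁`, when the strata in `J` are nearly deterministic and the others negligible. -/
lemma stratified_ratio_le {ι : Type*} [Fintype ι] {J : Set ι} {p m₁ m₂ : ι → ℝ} {j : ι} {δ : ℝ}
    (hδ : 0 < δ) (hδ1 : δ < 1) (hδd : Fintype.card ι * δ < 1) (hp : ∀ i, 0 < p i)
    (hm₁ : ∀ i, 0 ≤ m₁ i)
    (hJ : ∀ i ∈ J, m₂ i ≤ (1 + δ) * p i ^ 2 ∧ (1 - δ) * p i ≤ m₁ i)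
    (hJc : ∀ i ∉ J, m₂ i ≤ δ * p j * p i ∧ p i ≤ δ * p j) :
    (∑ i, p i) * (∑ i, m₂ i / p i) / (∑ i, m₁ i) ^ 2
      ≤ (1 + (Fintype.card ι + 1) * δ) / ((1 - δ) * (1 - Fintype.card ι * δ)) ^ 2 := by
  set n := (Fintype.card ι : ℝ)
  set P := ∑ i, p i
  have hjP : p j ≤ P := Finset.single_le_sum (fun i _ => (hp i).le) (Finset.mem_univ j)
  have hP : 0 < P := (hp j).trans_le hjP
  have h1 : ∀ i, m₂ i / p i ≤ (1 + δ) * p i + δ * P := by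
    intro i
    rw [div_le_iff₀ (hp i)]
    have hpi := hp i
    by_cases hi : i ∈ J
    · have := (hJ i hi).1
      have : 0 ≤ δ * P * p i := by positivity
      nlinarith
    · have h2 := (hJc i hi).1
      have h3 : δ * p j * p i ≤ δ * P * p i := by gcongr
      have : 0 ≤ (1 + δ) * p i * p i := by positivity
      nlinarith
  have h2 : ∑ i, m₂ i / p i ≤ (1 + (n + 1) * δ) * P := by
    refine (Finset.sum_le_sum fun i _ => h1 i).trans (le_of_eq ?_)
    rw [Finset.sum_add_distrib, ← Finset.mul_sum, Finset.sum_const, nsmul_eq_mul,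
      Finset.card_univ]
    ring
  have h3 : ∀ i, (1 - δ) * (p i - δ * P) ≤ m₁ i := by
    intro i
    by_cases hi : i ∈ J
    · refine le_trans ?_ (hJ i hi).2
      have : 0 ≤ δ * P := by positivity
      nlinarith
    · refine le_trans ?_ (hm₁ i)
      have h4 : p i ≤ δ * P := (hJc i hi).2.trans (by gcongr)
      nlinarith
  have h4 : (1 - δ) * (1 - n * δ) * P ≤ ∑ i, m₁ i := by
    refine le_trans (le_of_eq ?_) (Finset.sum_le_sum fun i _ => h3 i)
    rw [← Finset.mul_sum, Finset.sum_sub_distrib, Finset.sum_const, nsmul_eq_mul,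
      Finset.card_univ]
    ring
  have h5 : 0 < (1 - δ) * (1 - n * δ) := mul_pos (by linarith) (by linarith)
  calc P * (∑ i, m₂ i / p i) / (∑ i, m₁ i) ^ 2
      ≤ P * ((1 + (n + 1) * δ) * P) / ((1 - δ) * (1 - n * δ) * P) ^ 2 := by
        have hn : 0 ≤ n := Nat.cast_nonneg _
        gcongr
    _ = _ := by
        have : 1 - δ ≠ 0 := by linarith
        have : 1 - n * δ ≠ 0 := by linarith
        field_simp

end LogGaussian

end

/-! ### The relative error -/

theorem theorem1 {Ω : Type*} [MeasurableSpace Ω] (μ : Measure Ω) [IsProbabilityMeasure μ]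
    (d : ℕ) (hd : 1 ≤ d)
    -- independent standard Gaussian random variables
    (N : Fin d → Ω → ℝ) (hNm : ∀ i, Measurable (N i))
    (hN : ∀ i, μ.map (N i) = gaussianReal 0 1) (hNind : iIndepFun N μ)
    -- the parameters of the risks
    (lam bet : Fin d → ℝ) (hlam : ∀ i, 0 < lam i) (hbet : ∀ i, 0 < bet i)
    (g : ℝ → ℝ) (hg : ∀ u, 0 < u → 0 < g u)
    (g₀ : ℝ) (hg₀ : 0 < g₀) (hglim : Tendsto g atTop (𝓝 g₀))
    -- lower triangular non-singular matrices for which `A Aᵀ` is a correlation matrix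
    (A : ℝ → Matrix (Fin d) (Fin d) ℝ)
    (hAtri : ∀ u, 0 < u → ∀ i k, i < k → A u i k = 0)
    (hAdet : ∀ u, 0 < u → (A u).det ≠ 0)
    (hAcorr : ∀ u, 0 < u → ∀ i, LogGaussian.corr (A u) i i = 1)
    -- for each `j`, any factor of the same correlation matrix for which `Y j = N j`
    (B : ℝ → Fin d → Matrix (Fin d) (Fin d) ℝ)
    (hB : ∀ u, 0 < u → ∀ j, LogGaussian.IsFactorAt (LogGaussian.corr (A u)) j (B u j))
    -- the stratification variable, independent of the Gaussian vector
    (I : ℝ → Ω → Fin d) (hIm : ∀ u, 0 < u → Measurable (I u))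
    (hIind : ∀ u, 0 < u → IndepFun (I u) (fun ω k => N k ω) μ)
    (hI : ∀ u, 0 < u → ∀ i, μ.real {ω | I u ω = i} =
      LogGaussian.margTail μ lam bet (g u) (A u) N u i /
        ∑ k, LogGaussian.margTail μ lam bet (g u) (A u) N u k)
    -- the condition on the correlations
    (hcond : ∀ c : ℝ, 0 < c → ∀ ε : ℝ, 0 < ε → ∃ u₀ : ℝ, 0 < u₀ ∧ ∀ u, u₀ < u →
      ∀ i ∈ LogGaussian.maxIdx bet, ∀ j ∈ LogGaussian.maxIdx bet, i ≠ j →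
        LogGaussian.corr (A u) i j +
            c * Real.sqrt ((1 - LogGaussian.corr (A u) i j ^ 2) / Real.log u) ≤
          bet j / bet i *
            (Real.log (ε * LogGaussian.scaleStar (lam i) (bet i) (g u) u) / Real.log u)) :
    LogGaussian.VanishingRelativeError μ
      (fun u => LogGaussian.mak μ lam bet (g u) (A u) (B u) N (I u) u)
      (fun u => LogGaussian.tailProb μ lam bet (g u) (A u) N u) := by
  have hp : ∀ u, 0 < u → ∀ i, LogGaussian.margTail μ lam bet (g u) (A u) N u i
      = LogGaussian.gaussTail (LogGaussian.threshold (lam i) (bet i) (g u) u) :=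
    fun u hu i => LogGaussian.margTail_eq_gaussTail hNm hN hNind hlam hbet (hg u hu) hu
      (hAcorr u hu i)
  have hmom := fun u (hu : 0 < u) => LogGaussian.stratified_moments (μ := μ) (hIm u hu)
    (Z := fun i => LogGaussian.condEst μ lam bet (g u) (B u i) N u i)
    (fun i => LogGaussian.integrable_condEst.aestronglyMeasurable)
    (fun i => by
      filter_upwards [LogGaussian.condEst_nonneg (μ := μ) (lam := lam) (bet := bet) (g := g u)
        (B := B u i) (N := N) (u := u) (i := i), LogGaussian.condEst_le_one hNm] with ω h0 h1
      rwa [abs_of_nonneg h0])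
    (fun i => by
      rw [IndepFun_iff_Indep]
      refine indep_of_indep_of_le_right ((IndepFun_iff_Indep _ _ _).mp (hIind u hu)) ?_
      exact LogGaussian.stronglyMeasurable_condEst.measurable.comap_le.trans
        (LogGaussian.sigmaExcept_le_comap N i))
    (p := LogGaussian.margTail μ lam bet (g u) (A u) N u)
    (fun i => by rw [hp u hu]; exact LogGaussian.gaussTail_pos _) (hI u hu)
  have hα : ∀ u, 0 < u → ∑ i, ∫ ω, LogGaussian.condEst μ lam bet (g u) (B u i) N u i ω ∂μ
      = LogGaussian.tailProb μ lam bet (g u) (A u) N u := by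
    intro u hu
    simp_rw [LogGaussian.integral_condEst hNm]
    exact LogGaussian.sum_measureReal_maxEvent hd hNm hN hNind hlam hbet (hg u hu) (hAdet u hu)
      (hB u hu)
  have hmean : ∀ u, 0 < u → MemLp (LogGaussian.mak μ lam bet (g u) (A u) (B u) N (I u) u) 2 μ ∧
      ∫ ω, LogGaussian.mak μ lam bet (g u) (A u) (B u) N (I u) u ω ∂μ
        = LogGaussian.tailProb μ lam bet (g u) (A u) N u :=
    fun u hu => ⟨(hmom u hu).1, (hmom u hu).2.1.trans (hα u hu)⟩
  refine ⟨hmean, ?_⟩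
  obtain ⟨j₀, hj₀⟩ := LogGaussian.exists_mem_maxIdx (bet := bet) hd
  have hev : ∀ δ : ℝ, 0 < δ → ∀ᶠ u in atTop, ∀ i,
      (i ∈ LogGaussian.maxIdx bet →
        ∫ ω, LogGaussian.condEst μ lam bet (g u) (B u i) N u i ω ^ 2 ∂μ ≤ (1 + δ)
          * LogGaussian.gaussTail (LogGaussian.threshold (lam i) (bet i) (g u) u) ^ 2 ∧
        (1 - δ) * LogGaussian.gaussTail (LogGaussian.threshold (lam i) (bet i) (g u) u)
          ≤ ∫ ω, LogGaussian.condEst μ lam bet (g u) (B u i) N u i ω ∂μ) ∧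
      (i ∉ LogGaussian.maxIdx bet →
        ∫ ω, LogGaussian.condEst μ lam bet (g u) (B u i) N u i ω ^ 2 ∂μ ≤
          δ * LogGaussian.gaussTail (LogGaussian.threshold (lam j₀) (bet j₀) (g u) u)
            * LogGaussian.gaussTail (LogGaussian.threshold (lam i) (bet i) (g u) u) ∧
        LogGaussian.gaussTail (LogGaussian.threshold (lam i) (bet i) (g u) u) ≤
          δ * LogGaussian.gaussTail (LogGaussian.threshold (lam j₀) (bet j₀) (g u) u)) := by
    intro δ hδ
    refine eventually_all.mpr fun i => ?_
    by_cases hi : i ∈ LogGaussian.maxIdx bet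
    · filter_upwards [LogGaussian.eventually_moments_of_mem_maxIdx hNm hN hNind hlam hbet hg₀ hglim
        hAcorr hB hi (fun ε K hε hK => LogGaussian.eventually_othersBelow hlam hbet hg₀ hglim hAcorr
          hcond hi hε hK) hδ] with u h
      exact ⟨fun _ => h, fun h' => absurd hi h'⟩
    · filter_upwards [LogGaussian.eventually_moments_of_notMem_maxIdx hNm hN hNind hlam hbet hg₀
        hglim hB hj₀ hi hδ] with u h
      exact ⟨fun h' => absurd h' hi, fun _ => h⟩
  have hsecond : ∀ u, 0 < u → ∫ ω, (LogGaussian.mak μ lam bet (g u) (A u) (B u) N (I u) u ω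
      / LogGaussian.tailProb μ lam bet (g u) (A u) N u) ^ 2 ∂μ
      = (∫ ω, LogGaussian.mak μ lam bet (g u) (A u) (B u) N (I u) u ω ^ 2 ∂μ)
        / LogGaussian.tailProb μ lam bet (g u) (A u) N u ^ 2 := by
    intro u _
    simp_rw [div_pow]
    exact integral_div _ _
  have hm₁ : ∀ u i, 0 ≤ ∫ ω, LogGaussian.condEst μ lam bet (g u) (B u i) N u i ω ∂μ :=
    fun u i => integral_nonneg_of_ae LogGaussian.condEst_nonneg
  -- `E[Z²] ≥ (E[Z])²` gives the lower bound, for every `u` at which `α u` is positive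
  have hlower : ∀ᶠ u in atTop, 1 ≤ ∫ ω, (LogGaussian.mak μ lam bet (g u) (A u) (B u) N (I u) u ω
      / LogGaussian.tailProb μ lam bet (g u) (A u) N u) ^ 2 ∂μ := by
    filter_upwards [hev (1 / 2) (by norm_num), eventually_gt_atTop 0] with u h hu
    have hpos : 0 < LogGaussian.tailProb μ lam bet (g u) (A u) N u := by
      rw [← hα u hu]
      refine lt_of_lt_of_le ?_ (Finset.single_le_sum (fun i _ => hm₁ u i) (Finset.mem_univ j₀))
      refine lt_of_lt_of_le ?_ ((h j₀).1 hj₀).2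
      have := LogGaussian.gaussTail_pos (LogGaussian.threshold (lam j₀) (bet j₀) (g u) u)
      linarith
    rw [hsecond u hu, one_le_div (by positivity), ← (hmean u hu).2]
    have hvar := variance_nonneg (LogGaussian.mak μ lam bet (g u) (A u) (B u) N (I u) u) μ
    rw [variance_eq_sub (hmean u hu).1] at hvar
    simpa using hvar
  refine tendsto_order.mpr ⟨fun c hc => hlower.mono fun u h => hc.trans_le h, fun c hc => ?_⟩
  obtain ⟨δ, hδ, hδ1, hδd, hδc⟩ : ∃ δ : ℝ, 0 < δ ∧ δ < 1 ∧ Fintype.card (Fin d) * δ < 1 ∧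
      (1 + (Fintype.card (Fin d) + 1) * δ) / ((1 - δ) * (1 - Fintype.card (Fin d) * δ)) ^ 2 < c := by
    set n := (Fintype.card (Fin d) : ℝ)
    have h1 : Tendsto (fun δ : ℝ => (1 + (n + 1) * δ) / ((1 - δ) * (1 - n * δ)) ^ 2) (𝓝 0)
        (𝓝 ((1 + (n + 1) * 0) / ((1 - 0) * (1 - n * 0)) ^ 2)) := by
      refine Tendsto.div ?_ ?_ (by simp)
      · exact (by fun_prop : Continuous fun δ : ℝ => 1 + (n + 1) * δ).tendsto 0
      · exact (by fun_prop : Continuous fun δ : ℝ => ((1 - δ) * (1 - n * δ)) ^ 2).tendsto 0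
    have h2 : Tendsto (fun δ : ℝ => n * δ) (𝓝 0) (𝓝 (n * 0)) :=
      (by fun_prop : Continuous fun δ : ℝ => n * δ).tendsto 0
    have h3 := (h1.eventually_lt_const (show _ < c by simpa using hc)).and
      ((h2.eventually_lt_const (show n * 0 < 1 by simp)).and
        (eventually_lt_nhds (zero_lt_one (α := ℝ))))
    obtain ⟨δ, h4, h5⟩ := ((h3.filter_mono nhdsWithin_le_nhds).and
      (self_mem_nhdsWithin (s := Set.Ioi (0 : ℝ)))).exists
    exact ⟨δ, h5, h4.2.2, h4.2.1, h4.1⟩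
  filter_upwards [hev δ hδ, eventually_gt_atTop 0] with u h hu
  refine lt_of_le_of_lt ?_ hδc
  rw [hsecond u hu, ← hα u hu]
  have h2 : ∫ ω, LogGaussian.mak μ lam bet (g u) (A u) (B u) N (I u) u ω ^ 2 ∂μ = _ :=
    (hmom u hu).2.2
  rw [h2]
  simp_rw [hp u hu]
  exact LogGaussian.stratified_ratio_le (J := LogGaussian.maxIdx bet) (j := j₀) hδ hδ1 hδd
    (fun i => LogGaussian.gaussTail_pos _) (hm₁ u) (fun i hi => (h i).1 hi) (fun i hi => (h i).2 hi)
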